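/- Work over $\mathbb{C}$. Let $r\ge 1$ and let $\mathbf n=(n_1,\dots,n_r)$, $\mathbf d=(d_1,\dots,d_r)$ be $r$-tuples of positive integers with $n_1\le\dots\le n_r$ and $d_1+\dots+d_r\ge 3$. Let $SV^{\mathbf n}_{\mathbf d}\subset\mathbb P^N$, $N=\prod_i\binom{n_i+d_i}{d_i}-1$, be the Segre-Veronese variety, i.e. $\mathbb P^{n_1}\times\dots\times\mathbb P^{n_r}$ embedded by the complete linear system $|\mathcal O(d_1,\dots,d_r)|$. For a smooth irreducible variety $X\subset\mathbb P^N$, points $x_1,\dots,x_h\in X$ and a hyperplane $H$ containing $\langle T_{x_1}X,\dots,T_{x_h}X\rangle$, the contact locus $\Sigma_{x_1,\dots,x_h,H}$ is the union of the irreducible components of $\mathrm{Sing}(X\cap H)=\{x\in X: T_xX\subset H\}$ that contain at least one of the $x_i$. The variety $X$ is called $h$-weakly defective if, for general $x_1,\dots,x_h\in X$, there are hyperplanes containing $\langle T_{x_1}X,\dots,T_{x_h}X\rangle$, and for a general such hyperplane $H$ the locus $\Sigma_{x_1,\dots,x_h,H}$ has positive dimension. **Proposition.** Assume that $n_r>\sum_{i=1}^{r-1}n_i$.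 1. If $d_r\ge 2$ and $(\mathbf n,\mathbf d)\neq((1,2),(1,2))$, then $SV^{\mathbf n}_{\mathbf d}$ is not $(n_1+1)$-weakly defective. 2. If $d_r=1$, then $SV^{\mathbf n}_{\mathbf d}$ is $1$-weakly defective; moreover, for a general point $x\in SV^{\mathbf n}_{\mathbf d}$ and a general hyperplane $H\supset T_xSV^{\mathbf n}_{\mathbf d}$, the contact locus $\Sigma_{x,H}$ contains a linear space of dimension $n_r-\sum_{i=1}^{r-1}n_i>0$. -/

import Mathlib

open scoped LinearAlgebra.Projectivization

noncomputable section

/-! ### Complex projective space and its Zariski topology -/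

/-- The projective space `ℙ(ℂ^σ)`, with homogeneous coordinates indexed by `σ`. -/
def PSpace (σ : Type) : Type := ℙ ℂ (σ → ℂ)

/-- A vector of homogeneous coordinates of a point. -/
def PSpace.coord {σ : Type} (x : PSpace σ) : σ → ℂ := Projectivization.rep x

/-- The point with homogeneous coordinates `v`. -/
def PSpace.mk {σ : Type} (v : σ → ℂ) (hv : v ≠ 0) : PSpace σ := Projectivization.mk ℂ v hv

/-- The Zariski topology: the sets where a homogeneous polynomial does not vanish form a basis. -/
instance PSpace.zariski (σ : Type) : TopologicalSpace (PSpace σ) :=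
  TopologicalSpace.generateFrom
    {U | ∃ (m : ℕ) (F : MvPolynomial σ ℂ), F.IsHomogeneous m ∧
      U = {x | MvPolynomial.eval x.coord F ≠ 0}}

/-- The product `ℙ(ℂ^σ) × ⋯ × ℙ(ℂ^σ)` of `h` copies of a projective space. -/
def PTuple (h : ℕ) (σ : Type) : Type := Fin h → PSpace σ

/-- A polynomial in `h` groups of variables is multihomogeneous of multidegree `m` if, for each
`i`, it is homogeneous of degree `m i` in the `i`-th group. -/
def IsMultihomogeneous {h : ℕ} {σ : Type} (F : MvPolynomial (Fin h × σ) ℂ) (m : Fin h → ℕ) : Prop :=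
  ∀ i, F.IsWeightedHomogeneous (fun p : Fin h × σ => if p.1 = i then 1 else 0) (m i)

/-- The Zariski topology of a product of projective spaces (finer than the product topology): the
sets where a multihomogeneous polynomial does not vanish form a basis. -/
instance PTuple.zariski (h : ℕ) (σ : Type) : TopologicalSpace (PTuple h σ) :=
  TopologicalSpace.generateFrom
    {U | ∃ (m : Fin h → ℕ) (F : MvPolynomial (Fin h × σ) ℂ), IsMultihomogeneous F m ∧
      U = {x | MvPolynomial.eval (fun p : Fin h × σ => (x p.1).coord p.2) F ≠ 0}}

/-- `P` holds for a general element of the (irreducible) set `Z`: it holds on a nonempty relatively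
open subset of `Z`. -/
def ForGeneral {Y : Type} [TopologicalSpace Y] (Z : Set Y) (P : Y → Prop) : Prop :=
  ∃ U : Set Y, IsOpen U ∧ (Z ∩ U).Nonempty ∧ ∀ y ∈ Z ∩ U, P y

/-! ### Tangent spaces, contact loci, weak defectiveness -/

section

variable {σ : Type} [Fintype σ]

/-- The embedded projective tangent space of `X` at `x`, as a linear subspace of `ℂ^σ`: the common
zeros of the differentials at `x` of the homogeneous polynomials that vanish on `X`. -/
def tangentSpaceAt (X : Set (PSpace σ)) (x : PSpace σ) : Submodule ℂ (σ → ℂ) where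
  carrier := {v | ∀ (m : ℕ) (F : MvPolynomial σ ℂ), F.IsHomogeneous m →
    (∀ y ∈ X, MvPolynomial.eval y.coord F = 0) →
    ∑ s, MvPolynomial.eval x.coord (MvPolynomial.pderiv s F) * v s = 0}
  add_mem' := by
    intro v w hv hw m F hF h0
    simp only [Pi.add_apply, mul_add, Finset.sum_add_distrib]
    rw [hv m F hF h0, hw m F hF h0, add_zero]
  zero_mem' := by
    intro m F _ _
    simp
  smul_mem' := by
    intro c v hv m F hF h0
    have h := hv m F hF h0
    simp only [Pi.smul_apply, smul_eq_mul, mul_left_comm _ c, ← Finset.mul_sum]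
    rw [h, mul_zero]

/-- The hyperplane `∑ a_s X_s = 0`, as a linear subspace of `ℂ^σ`. A hyperplane is given by the
point `a` of the dual projective space, so that it makes sense to speak of a general hyperplane. -/
def hyperplane (a : PSpace σ) : Submodule ℂ (σ → ℂ) where
  carrier := {v | ∑ s, a.coord s * v s = 0}
  add_mem' := by
    intro v w hv hw
    simp only [Set.mem_ofPred_eq] at hv hw ⊢
    simp only [Pi.add_apply, mul_add, Finset.sum_add_distrib]
    rw [hv, hw, add_zero]
  zero_mem' := by simp
  smul_mem' := by
    intro c v hv
    simp only [Set.mem_ofPred_eq] at hv ⊢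
    simp only [Pi.smul_apply, smul_eq_mul, mul_left_comm _ c, ← Finset.mul_sum]
    rw [hv, mul_zero]

/-- The singular locus `Sing(X ∩ H)` of a hyperplane section of a smooth variety `X`: the points of
`X` at which the hyperplane is tangent to `X`. -/
def singHyperplaneSection (X : Set (PSpace σ)) (a : PSpace σ) : Set (PSpace σ) :=
  {x | x ∈ X ∧ tangentSpaceAt X x ≤ hyperplane a}

/-- The irreducible components of a subset `S`: its maximal irreducible subsets. -/
def componentsOf {Y : Type} [TopologicalSpace Y] (S : Set Y) : Set (Set Y) :=
  {C | Maximal (fun D : Set Y => IsIrreducible D ∧ D ⊆ S) C}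

/-- The contact locus `Σ_{x_1,…,x_h,H}`: the union of the irreducible components of `Sing(X ∩ H)`
that contain at least one of the `x_i`. -/
def contactLocus {h : ℕ} (X : Set (PSpace σ)) (x : PTuple h σ) (a : PSpace σ) : Set (PSpace σ) :=
  ⋃₀ {C | C ∈ componentsOf (singHyperplaneSection X a) ∧ ∃ i, x i ∈ C}

/-- The `h`-tuples of points of `X`. -/
def tuplesIn (h : ℕ) (X : Set (PSpace σ)) : Set (PTuple h σ) := {x | ∀ i, x i ∈ X}

/-- The hyperplanes containing `⟨T_{x_1} X, …, T_{x_h} X⟩`. -/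
def tangentHyperplanes {h : ℕ} (X : Set (PSpace σ)) (x : PTuple h σ) : Set (PSpace σ) :=
  {a | (⨆ i, tangentSpaceAt X (x i)) ≤ hyperplane a}

/-- The (smooth, irreducible) variety `X` is `h`-weakly defective: for general `x_1,…,x_h` in `X`
there are hyperplanes containing `⟨T_{x_1} X, …, T_{x_h} X⟩`, and for a general one among them the
contact locus has positive dimension. -/
def IsWeaklyDefective (X : Set (PSpace σ)) (h : ℕ) : Prop :=
  ForGeneral (tuplesIn h X) fun x =>
    ForGeneral (tangentHyperplanes X x) fun a =>
      0 < topologicalKrullDim (contactLocus X x a)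

/-- `S` contains a linear subspace of projective space of (projective) dimension `m`. -/
def ContainsLinearSpace (S : Set (PSpace σ)) (m : ℕ) : Prop :=
  ∃ L : Submodule ℂ (σ → ℂ), Module.finrank ℂ L = m + 1 ∧ ∀ x : PSpace σ, x.coord ∈ L → x ∈ S

end

/-! ### Segre-Veronese varieties -/

/-- The index set of the homogeneous coordinates: tuples `(J_1,…,J_r)`, where `J_i` is a multiset of
`d_i` elements of `{0,…,n_i}`. -/
abbrev SVIndex {r : ℕ} (n d : Fin r → ℕ) : Type := (i : Fin r) → Sym (Fin (n i + 1)) (d i)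

/-- All the monomials of multidegree `d` evaluated at `(y_1,…,y_r)`. -/
def svVec {r : ℕ} (n d : Fin r → ℕ) (y : (i : Fin r) → Fin (n i + 1) → ℂ) : SVIndex n d → ℂ :=
  fun J => ∏ i, ((J i : Multiset (Fin (n i + 1))).map (y i)).prod

theorem svVec_ne_zero {r : ℕ} (n d : Fin r → ℕ) (y : (i : Fin r) → Fin (n i + 1) → ℂ)
    (hy : ∀ i, y i ≠ 0) : svVec n d y ≠ 0 := by
  have h : ∀ i, ∃ k, y i k ≠ 0 := fun i => Function.ne_iff.mp (hy i)
  choose k hk using h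
  intro h0
  have h1 := congrFun h0 (fun i => Sym.replicate (d i) (k i))
  simp only [svVec, Pi.zero_apply, Finset.prod_eq_zero_iff, Finset.mem_univ, true_and] at h1
  obtain ⟨i, hi⟩ := h1
  simp only [Sym.coe_replicate, Multiset.map_replicate, Multiset.prod_replicate] at hi
  exact pow_ne_zero (d i) (hk i) hi

/-- The embedding of `ℙ^{n_1} × ⋯ × ℙ^{n_r}` by the complete linear system `|O(d_1,…,d_r)|`. -/
def svMap {r : ℕ} (n d : Fin r → ℕ) (y : (i : Fin r) → PSpace (Fin (n i + 1))) :
    PSpace (SVIndex n d) :=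
  PSpace.mk (svVec n d fun i => (y i).coord)
    (svVec_ne_zero n d _ fun i => Projectivization.rep_nonzero (y i))

/-- The Segre-Veronese variety. -/
def segreVeronese {r : ℕ} (n d : Fin r → ℕ) : Set (PSpace (SVIndex n d)) :=
  Set.range (svMap n d)

end

/-! A hyperplane is a multihomogeneous form of multidegree `d`, and it is tangent at the image of
`y` exactly when the form and its first derivatives vanish at `y`
(`tangentSpaceAt_le_hyperplane_iff`). Both claims are thus about critical points of forms.

Last degree at least two. A nondegenerate critical point is isolated in the singular locus
(`exists_isOpen_singHyperplaneSection_eq`), so it suffices to find, near any given tangent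
hyperplane, a form critical at all `n 0 + 1` points with invertible Hessian at each. Any nonempty
open set of tuples contains one that linear changes of coordinates in the factors carry to the
diagonal coordinate points. Invertibility of a Hessian is an open condition on the linear space of
critical forms, so one suitable form per point is enough (`not_isWeaklyDefective_of_chartHessian`).
In the chart at a coordinate point, a product of two chart variables may occur in the quadratic part
as soon as its monomial is critical at the other coordinate points too; `IsAdmissiblePair` gives a
numerical condition for this. What remains is a nondegenerate symmetric matrix supported on
admissible pairs. Variables of the other factors are matched with variables of the last one, which
are more numerous, and the unmatched ones are squared. In total degree three fewer pairs are
admissible, and separate patterns are needed; binary cubics drop out because none but zero is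
singular at two points.

Last degree one. The form is linear in the last group of variables. If it is critical at `y`, then,
with the other coordinates of `y` fixed, it vanishes identically in the last group. Being critical
is then a linear condition there, with `n i` equations for each other factor `i` by Euler's
relation. The solutions form a linear space of critical points through the given point
(`exists_submodule_isCritical_update_last`); it is irreducible, so it lies in the contact locus. -/

noncomputable section

/-! ### Homogeneous coordinates -/

/-- `v` is a vector of homogeneous coordinates of `x`. -/
def IsCoord {σ : Type} (x : PSpace σ) (v : σ → ℂ) : Prop := ∃ c : ℂ, c ≠ 0 ∧ x.coord = c • v

theorem PSpace.coord_ne_zero {σ : Type} (x : PSpace σ) : x.coord ≠ 0 :=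
  Projectivization.rep_nonzero x

theorem isCoord_coord {σ : Type} (x : PSpace σ) : IsCoord x x.coord := ⟨1, one_ne_zero, by simp⟩

theorem isCoord_mk {σ : Type} (v : σ → ℂ) (hv : v ≠ 0) : IsCoord (PSpace.mk v hv) v := by
  obtain ⟨c, hc⟩ := Projectivization.exists_smul_eq_mk_rep ℂ v hv
  exact ⟨c, c.ne_zero, hc.symm⟩

theorem IsCoord.ne_zero {σ : Type} {x : PSpace σ} {v : σ → ℂ} (h : IsCoord x v) : v ≠ 0 := by
  rintro rfl
  obtain ⟨c, -, hx⟩ := h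
  exact x.coord_ne_zero (by simpa using hx)

theorem IsCoord.smul {σ : Type} {x : PSpace σ} {v : σ → ℂ} (h : IsCoord x v) {c : ℂ} (hc : c ≠ 0) :
    IsCoord x (c • v) := by
  obtain ⟨b, hb, hx⟩ := h
  exact ⟨b * c⁻¹, mul_ne_zero hb (inv_ne_zero hc), by rw [hx, smul_smul, mul_assoc,
    inv_mul_cancel₀ hc, mul_one]⟩

theorem IsCoord.eq {σ : Type} {x y : PSpace σ} {v : σ → ℂ} (hx : IsCoord x v) (hy : IsCoord y v) :
    x = y := by
  obtain ⟨b, hb, hx⟩ := hx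
  obtain ⟨c, hc, hy⟩ := hy
  have h : Projectivization.mk ℂ (Projectivization.rep x) (Projectivization.rep_nonzero x) =
      Projectivization.mk ℂ (Projectivization.rep y) (Projectivization.rep_nonzero y) := by
    rw [Projectivization.mk_eq_mk_iff']
    refine ⟨b * c⁻¹, ?_⟩
    change (b * c⁻¹) • y.coord = x.coord
    rw [hx, hy, smul_smul, mul_assoc, inv_mul_cancel₀ hc, mul_one]
  exact (Projectivization.mk_rep _).symm.trans (h.trans (Projectivization.mk_rep _))

/-- `coord` is an arbitrary representative; homogeneity makes nonvanishing, hence the basic open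
sets, independent of that choice. -/
theorem MvPolynomial.IsHomogeneous.eval_smul_eq {σ : Type} [Fintype σ] {F : MvPolynomial σ ℂ} {m : ℕ}
    (hF : F.IsHomogeneous m) (c : ℂ) (v : σ → ℂ) :
    MvPolynomial.eval (c • v) F = c ^ m * MvPolynomial.eval v F := by
  rw [MvPolynomial.eval_eq', MvPolynomial.eval_eq', Finset.mul_sum]
  refine Finset.sum_congr rfl fun e he => ?_
  have h := hF (MvPolynomial.mem_support_iff.mp he)
  rw [Finsupp.weight_apply, Finsupp.sum_fintype _ _ (by simp)] at h
  simp only [Pi.smul_apply, smul_eq_mul, mul_pow, Finset.prod_mul_distrib, Finset.prod_pow_eq_pow_sum]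
  simp only [Pi.one_apply, smul_eq_mul, mul_one] at h
  rw [h]
  ring

theorem IsMultihomogeneous.eval_smul_eq {h : ℕ} {σ : Type} [Fintype σ]
    {F : MvPolynomial (Fin h × σ) ℂ} {m : Fin h → ℕ}
    (hF : IsMultihomogeneous F m) (c : Fin h → ℂ) (v : Fin h → σ → ℂ) :
    MvPolynomial.eval (fun p => (c p.1 • v p.1) p.2) F =
      (∏ i, c i ^ m i) * MvPolynomial.eval (fun p => v p.1 p.2) F := by
  rw [MvPolynomial.eval_eq', MvPolynomial.eval_eq', Finset.mul_sum]
  refine Finset.sum_congr rfl fun e he => ?_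
  have hw : ∀ i, ∑ s, e (i, s) = m i := fun i => by
    have h := hF i (MvPolynomial.mem_support_iff.mp he)
    rw [Finsupp.weight_apply, Finsupp.sum_fintype _ _ (by simp), Fintype.sum_prod_type] at h
    simpa [Finset.sum_ite, Finset.sum_comm] using h
  simp only [Pi.smul_apply, smul_eq_mul, mul_pow, Finset.prod_mul_distrib, Fintype.prod_prod_type]
  simp only [Finset.prod_pow_eq_pow_sum, hw]
  ring

/-! ### The Zariski topology -/

theorem PSpace.isOpen_eval_ne_zero {σ : Type} {m : ℕ} {F : MvPolynomial σ ℂ}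
    (hF : F.IsHomogeneous m) : IsOpen {x : PSpace σ | MvPolynomial.eval x.coord F ≠ 0} :=
  TopologicalSpace.isOpen_generateFrom_of_mem ⟨m, F, hF, rfl⟩

theorem eval_eval_aeval {σ : Type} (P : σ → Polynomial ℂ) (F : MvPolynomial σ ℂ) (t : ℂ) :
    (MvPolynomial.aeval P F).eval t = MvPolynomial.eval (fun s => (P s).eval t) F := by
  induction F using MvPolynomial.induction_on with
  | C a => simp
  | add p q hp hq => simp [hp, hq]
  | mul_X p s hp => simp [hp]

theorem Polynomial.eventually_cofinite_eval_ne_zero {p : Polynomial ℂ} {t₀ : ℂ}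
    (h : p.eval t₀ ≠ 0) : ∀ᶠ t in Filter.cofinite, p.eval t ≠ 0 := by
  have hp : p ≠ 0 := by rintro rfl; simp at h
  refine (Polynomial.finite_setOfPred_isRoot hp).subset fun t ht => ?_
  simpa using ht

/-- A polynomial curve that meets an open set stays in it, up to finitely many parameters. -/
theorem PSpace.eventually_mem {σ : Type} [Fintype σ] {U : Set (PSpace σ)} (hU : IsOpen U)
    (P : σ → Polynomial ℂ) (t₀ : ℂ) (x₀ : PSpace σ) (hx₀ : x₀ ∈ U)
    (h₀ : IsCoord x₀ fun s => (P s).eval t₀) :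
    ∀ᶠ t in Filter.cofinite, ∀ x, IsCoord x (fun s => (P s).eval t) → x ∈ U := by
  -- Cofinite sets of parameters are stable under finite intersection, and for a union one member
  -- suffices, so only basic open sets matter. There the composite with the curve is a one-variable
  -- polynomial that is nonzero at `t₀`.
  induction hU with
  | basic s hs =>
    obtain ⟨m, F, hF, rfl⟩ := hs
    obtain ⟨c, hc, h₀⟩ := h₀
    have h1 : (MvPolynomial.aeval P F).eval t₀ ≠ 0 := by
      rw [eval_eval_aeval]
      intro h
      rw [Set.mem_ofPred_eq, h₀, hF.eval_smul_eq, h, mul_zero] at hx₀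
      exact hx₀ rfl
    filter_upwards [Polynomial.eventually_cofinite_eval_ne_zero h1] with t ht x hx
    obtain ⟨b, hb, hx⟩ := hx
    rw [hx, hF.eval_smul_eq]
    rw [eval_eval_aeval] at ht
    exact mul_ne_zero (pow_ne_zero _ hb) ht
  | univ => simp
  | inter s t _ _ hs ht =>
    filter_upwards [hs hx₀.1, ht hx₀.2] with t h1 h2 x hx
    exact ⟨h1 x hx, h2 x hx⟩
  | sUnion S _ ih =>
    obtain ⟨s, hs, hx⟩ := hx₀
    filter_upwards [ih s hs hx] with t h x hx
    exact ⟨s, hs, h x hx⟩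

/-- A polynomial curve that meets an open set stays in it, up to finitely many parameters. -/
theorem PTuple.eventually_mem {h : ℕ} {σ : Type} [Fintype σ] {U : Set (PTuple h σ)} (hU : IsOpen U)
    (P : Fin h → σ → Polynomial ℂ) (t₀ : ℂ) (x₀ : PTuple h σ) (hx₀ : x₀ ∈ U)
    (h₀ : ∀ i, IsCoord (x₀ i) fun s => (P i s).eval t₀) :
    ∀ᶠ t in Filter.cofinite, ∀ x : PTuple h σ, (∀ i, IsCoord (x i) fun s => (P i s).eval t) →
      x ∈ U := by
  induction hU with
  | basic s hs =>
    obtain ⟨m, F, hF, rfl⟩ := hs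
    choose c hc h₀ using h₀
    have h1 : (MvPolynomial.aeval (fun p : Fin h × σ => P p.1 p.2) F).eval t₀ ≠ 0 := by
      rw [eval_eval_aeval]
      intro h
      rw [Set.mem_ofPred_eq] at hx₀
      simp only [h₀] at hx₀
      rw [hF.eval_smul_eq c (fun i s => (P i s).eval t₀), h, mul_zero] at hx₀
      exact hx₀ rfl
    filter_upwards [Polynomial.eventually_cofinite_eval_ne_zero h1] with t ht x hx
    choose b hb hx using hx
    simp only [hx]
    rw [hF.eval_smul_eq b (fun i s => (P i s).eval t)]
    rw [eval_eval_aeval] at ht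
    exact mul_ne_zero (Finset.prod_ne_zero_iff.mpr fun i _ => pow_ne_zero _ (hb i)) ht
  | univ => simp
  | inter s t _ _ hs ht =>
    filter_upwards [hs hx₀.1, ht hx₀.2] with t h1 h2 x hx
    exact ⟨h1 x hx, h2 x hx⟩
  | sUnion S _ ih =>
    obtain ⟨s, hs, hx⟩ := hx₀
    filter_upwards [ih s hs hx] with t h x hx
    exact ⟨s, hs, h x hx⟩

/-- The linear form `X s` and the forms `y_s X_k - y_k X_s`, which vanish at `y`, already separate
`x` from `y`: otherwise the coordinates would be proportional. -/
instance PSpace.t1Space (σ : Type) [Fintype σ] : T1Space (PSpace σ) := by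
  classical
  rw [t1Space_iff_exists_open]
  intro x y hxy
  obtain ⟨s, hs⟩ := Function.ne_iff.mp x.coord_ne_zero
  by_contra hcon
  push Not at hcon
  have key : ∀ (m : ℕ) (F : MvPolynomial σ ℂ), F.IsHomogeneous m →
      MvPolynomial.eval x.coord F ≠ 0 → MvPolynomial.eval y.coord F ≠ 0 := fun m F hF hx =>
    hcon _ (PSpace.isOpen_eval_ne_zero hF) hx
  have h1 : y.coord s ≠ 0 := by
    simpa using key 1 (MvPolynomial.X s) (MvPolynomial.isHomogeneous_X ℂ s) (by simpa using hs)
  have h2 : ∀ k, x.coord k * y.coord s = x.coord s * y.coord k := fun k => by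
    by_contra h
    have := key 1 (MvPolynomial.C (y.coord s) * MvPolynomial.X k -
      MvPolynomial.C (y.coord k) * MvPolynomial.X s)
      ((MvPolynomial.isHomogeneous_C_mul_X _ _).sub (MvPolynomial.isHomogeneous_C_mul_X _ _))
      (by simp only [map_sub, map_mul, MvPolynomial.eval_C, MvPolynomial.eval_X]
          intro h'; apply h; linear_combination h')
    simp [mul_comm] at this
  refine hxy (IsCoord.eq (v := y.coord) ⟨x.coord s / y.coord s, div_ne_zero hs h1, ?_⟩
    (isCoord_coord y))
  ext k
  have := h2 k
  simp only [Pi.smul_apply, smul_eq_mul]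
  field_simp
  exact this

/-! ### Monomials and multihomogeneous forms over an algebra -/


section

variable {r : ℕ} {n d : Fin r → ℕ} {R S : Type} [CommRing R] [CommRing S]

/-- The monomial of index `J` evaluated at a point with coordinates in a ring. -/
def svMonomial (z : (i : Fin r) → Fin (n i + 1) → R) (J : SVIndex n d) : R :=
  ∏ i, ((J i : Multiset (Fin (n i + 1))).map (z i)).prod

/-- The index of the monomial given by a variable for each slot. -/
def slotIndex (φ : (i : Fin r) → Fin (d i) → Fin (n i + 1)) : SVIndex n d :=
  fun i => ⟨Multiset.map (φ i) Finset.univ.val, by simp⟩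

theorem svMonomial_slotIndex (z : (i : Fin r) → Fin (n i + 1) → R)
    (φ : (i : Fin r) → Fin (d i) → Fin (n i + 1)) :
    svMonomial z (slotIndex φ) = ∏ i, ∏ s, z i (φ i s) := by
  simp [svMonomial, slotIndex, Finset.prod, Function.comp_def]

/-- Labelling the slots turns a monomial into a product over `Fin (d i)`, which can be expanded or
altered one slot at a time. -/
theorem slotIndex_surjective :
    Function.Surjective (slotIndex : ((i : Fin r) → Fin (d i) → Fin (n i + 1)) → SVIndex n d) := by
  intro J
  have h : ∀ i, ∃ f : Fin (d i) → Fin (n i + 1), Multiset.map f Finset.univ.val = (J i).1 := by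
    intro i
    generalize J i = K
    generalize d i = e at K
    obtain ⟨m, hm⟩ := K
    induction m using Quotient.inductionOn with
    | h l =>
      simp only [Multiset.quot_mk_to_coe, Multiset.coe_card] at hm
      subst hm
      refine ⟨l.get, ?_⟩
      simp [Fin.univ_val_map]
  choose φ hφ using h
  exact ⟨φ, funext fun i => Subtype.ext (hφ i)⟩

theorem svMonomial_mul (c : Fin r → R) (z : (i : Fin r) → Fin (n i + 1) → R) (J : SVIndex n d) :
    svMonomial (fun i k => c i * z i k) J = (∏ i, c i ^ d i) * svMonomial z J := by
  simp [svMonomial, Multiset.prod_map_mul, Finset.prod_mul_distrib]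

variable [Algebra ℂ R] [Algebra ℂ S]

/-- The form with coefficients `a` evaluated at a point with coordinates in a `ℂ`-algebra. -/
def svForm (a : SVIndex n d → ℂ) (z : (i : Fin r) → Fin (n i + 1) → R) : R :=
  ∑ J, algebraMap ℂ R (a J) * svMonomial z J

theorem svForm_mul (a : SVIndex n d → ℂ) (c : Fin r → R) (z : (i : Fin r) → Fin (n i + 1) → R) :
    svForm a (fun i k => c i * z i k) = (∏ i, c i ^ d i) * svForm a z := by
  simp only [svForm, svMonomial_mul, Finset.mul_sum]
  exact Finset.sum_congr rfl fun J _ => by ring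

theorem map_svMonomial (f : R →ₐ[ℂ] S) (z : (i : Fin r) → Fin (n i + 1) → R) (J : SVIndex n d) :
    f (svMonomial z J) = svMonomial (fun i k => f (z i k)) J := by
  simp [svMonomial, map_prod, map_multiset_prod]

theorem map_svForm (f : R →ₐ[ℂ] S) (a : SVIndex n d → ℂ) (z : (i : Fin r) → Fin (n i + 1) → R) :
    f (svForm a z) = svForm a (fun i k => f (z i k)) := by
  simp [svForm, map_svMonomial]

theorem svForm_add (a b : SVIndex n d → ℂ) (z : (i : Fin r) → Fin (n i + 1) → R) :
    svForm (a + b) z = svForm a z + svForm b z := by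
  simp [svForm, add_mul, Finset.sum_add_distrib]

theorem svForm_smul (c : ℂ) (a : SVIndex n d → ℂ) (z : (i : Fin r) → Fin (n i + 1) → R) :
    svForm (c • a) z = algebraMap ℂ R c * svForm a z := by
  simp [svForm, Finset.mul_sum, mul_assoc]

theorem svForm_zero (z : (i : Fin r) → Fin (n i + 1) → R) :
    svForm (0 : SVIndex n d → ℂ) z = 0 := by
  simp [svForm]

theorem svForm_sum {ι : Type} (s : Finset ι) (a : ι → SVIndex n d → ℂ)
    (z : (i : Fin r) → Fin (n i + 1) → R) :
    svForm (∑ j ∈ s, a j) z = ∑ j ∈ s, svForm (a j) z := by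
  classical
  induction s using Finset.induction_on with
  | empty => simp [svForm_zero]
  | insert j s hj ih => rw [Finset.sum_insert hj, Finset.sum_insert hj, svForm_add, ih]

theorem svForm_single (J : SVIndex n d) (z : (i : Fin r) → Fin (n i + 1) → R) :
    svForm (Pi.single J 1) z = svMonomial z J := by
  classical
  rw [svForm, Finset.sum_eq_single J] <;> simp +contextual

/-- Linear substitution in each group of variables. -/
def linearSubst (g : (i : Fin r) → Matrix (Fin (n i + 1)) (Fin (n i + 1)) ℂ)
    (z : (i : Fin r) → Fin (n i + 1) → R) : (i : Fin r) → Fin (n i + 1) → R :=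
  fun i m => ∑ k, algebraMap ℂ R (g i m k) * z i k

theorem linearSubst_mul (g g' : (i : Fin r) → Matrix (Fin (n i + 1)) (Fin (n i + 1)) ℂ)
    (z : (i : Fin r) → Fin (n i + 1) → R) :
    linearSubst (fun i => g i * g' i) z = linearSubst g (linearSubst g' z) := by
  funext i m
  simp only [linearSubst, Matrix.mul_apply, map_sum, map_mul, Finset.sum_mul, Finset.mul_sum]
  rw [Finset.sum_comm]
  exact Finset.sum_congr rfl fun _ _ => Finset.sum_congr rfl fun _ _ => by ring

theorem linearSubst_one (z : (i : Fin r) → Fin (n i + 1) → R) :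
    linearSubst (fun _ => 1) z = z := by
  funext i m
  simp [linearSubst, Matrix.one_apply]

theorem linearSubst_inv {g : (i : Fin r) → Matrix (Fin (n i + 1)) (Fin (n i + 1)) ℂ}
    (hg : ∀ i, (g i).det ≠ 0) (z : (i : Fin r) → Fin (n i + 1) → R) :
    linearSubst g (linearSubst (fun i => (g i)⁻¹) z) = z := by
  rw [← linearSubst_mul]
  conv_rhs => rw [← linearSubst_one z]
  congr 1
  funext i
  exact Matrix.mul_nonsing_inv _ (isUnit_iff_ne_zero.mpr (hg i))

theorem linearSubst_inv' {g : (i : Fin r) → Matrix (Fin (n i + 1)) (Fin (n i + 1)) ℂ}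
    (hg : ∀ i, (g i).det ≠ 0) (z : (i : Fin r) → Fin (n i + 1) → R) :
    linearSubst (fun i => (g i)⁻¹) (linearSubst g z) = z := by
  rw [← linearSubst_mul]
  conv_rhs => rw [← linearSubst_one z]
  congr 1
  funext i
  exact Matrix.nonsing_inv_mul _ (isUnit_iff_ne_zero.mpr (hg i))

theorem map_linearSubst (f : R →ₐ[ℂ] S)
    (g : (i : Fin r) → Matrix (Fin (n i + 1)) (Fin (n i + 1)) ℂ)
    (z : (i : Fin r) → Fin (n i + 1) → R) (i : Fin r) (m : Fin (n i + 1)) :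
    f (linearSubst g z i m) = linearSubst g (fun i k => f (z i k)) i m := by
  simp [linearSubst]

/-- A linear substitution turns a form into a form. -/
theorem exists_svForm_eq_linearSubst (b : SVIndex n d → ℂ)
    (g : (i : Fin r) → Matrix (Fin (n i + 1)) (Fin (n i + 1)) ℂ) :
    ∃ a : SVIndex n d → ℂ, ∀ (R : Type) [CommRing R] [Algebra ℂ R]
      (z : (i : Fin r) → Fin (n i + 1) → R), svForm a z = svForm b (linearSubst g z) := by
  classical
  -- It is enough to expand one monomial by distributivity, choosing a variable in each slot. The
  -- coefficients serve all algebras at once, so the identity applies to complex points, dual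
  -- numbers and polynomials alike.
  have key : ∀ J : SVIndex n d, ∃ a : SVIndex n d → ℂ, ∀ (R : Type) [CommRing R] [Algebra ℂ R]
      (z : (i : Fin r) → Fin (n i + 1) → R), svForm a z = svMonomial (linearSubst g z) J := by
    intro J
    obtain ⟨φ, rfl⟩ := slotIndex_surjective J
    refine ⟨∑ ψ : (i : Fin r) → Fin (d i) → Fin (n i + 1),
      (∏ i, ∏ s, g i (φ i s) (ψ i s)) • Pi.single (slotIndex ψ) 1, fun R _ _ z => ?_⟩
    rw [svForm_sum, svMonomial_slotIndex]
    simp only [linearSubst, Fintype.prod_sum]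
    refine Finset.sum_congr rfl fun ψ _ => ?_
    rw [svForm_smul, svForm_single, svMonomial_slotIndex]
    simp [Finset.prod_mul_distrib]
  choose A hA using key
  refine ⟨∑ J, b J • A J, fun R _ _ z => ?_⟩
  rw [svForm_sum, svForm]
  exact Finset.sum_congr rfl fun J _ => by rw [svForm_smul, hA]

theorem svVec_eq_svMonomial (z : (i : Fin r) → Fin (n i + 1) → ℂ) : svVec n d z = svMonomial z :=
  rfl

theorem svForm_complex (a : SVIndex n d → ℂ) (z : (i : Fin r) → Fin (n i + 1) → ℂ) :
    svForm a z = ∑ J, a J * svVec n d z J := rfl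

/-- A form that vanishes at all points is zero. -/
theorem eq_zero_of_svForm_eq_zero (a : SVIndex n d → ℂ)
    (h : ∀ z : (i : Fin r) → Fin (n i + 1) → ℂ, svForm a z = 0) : a = 0 := by
  classical
  -- The exponent vector of the monomial `J`; distinct indices have distinct exponents, so each `a
  -- J` is a coefficient of the polynomial.
  let e : SVIndex n d → ((Σ i : Fin r, Fin (n i + 1)) →₀ ℕ) := fun J =>
    Finsupp.equivFunOnFinite.symm fun p => Multiset.count p.2 (J p.1).1
  have he : Function.Injective e := by
    intro J J' hJ
    funext i
    apply Subtype.ext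
    ext k
    exact DFunLike.congr_fun hJ ⟨i, k⟩
  have hm : ∀ J, svMonomial (fun i k => (MvPolynomial.X ⟨i, k⟩ :
      MvPolynomial (Σ i : Fin r, Fin (n i + 1)) ℂ)) J = MvPolynomial.monomial (e J) 1 := by
    intro J
    rw [MvPolynomial.monomial_eq, Finsupp.prod_fintype _ _ (by simp), svMonomial, MvPolynomial.C_1,
      one_mul, Fintype.prod_sigma]
    refine Finset.prod_congr rfl fun i _ => ?_
    rw [Finset.prod_multiset_map_count]
    refine Finset.prod_subset (Finset.subset_univ _) fun k _ hk => ?_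
    simp only [Multiset.mem_toFinset] at hk
    rw [Multiset.count_eq_zero_of_notMem hk, pow_zero]
  have h0 : svForm a (fun i k => (MvPolynomial.X ⟨i, k⟩ :
      MvPolynomial (Σ i : Fin r, Fin (n i + 1)) ℂ)) = 0 := by
    refine MvPolynomial.funext fun u => ?_
    have := map_svForm (MvPolynomial.aeval u) a (fun i k => (MvPolynomial.X ⟨i, k⟩ :
      MvPolynomial (Σ i : Fin r, Fin (n i + 1)) ℂ))
    rw [map_zero]
    refine this.trans ?_
    exact h _
  funext J
  have h1 := congrArg (MvPolynomial.coeff (e J)) h0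
  simp only [svForm, hm, MvPolynomial.coeff_sum, MvPolynomial.algebraMap_eq,
    MvPolynomial.coeff_C_mul, MvPolynomial.coeff_monomial, he.eq_iff] at h1
  simpa using h1

end

/-! ### Dual numbers and tangent spaces -/

/-- First-order Taylor expansion, since `ε ^ 2 = 0`: derivatives are handled below by evaluating at
dual points. -/
theorem fst_snd_aeval {σ : Type} [Fintype σ] (u : σ → DualNumber ℂ) (F : MvPolynomial σ ℂ) :
    (MvPolynomial.aeval u F).fst = MvPolynomial.eval (fun s => (u s).fst) F ∧
    (MvPolynomial.aeval u F).snd =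
      ∑ s, MvPolynomial.eval (fun s => (u s).fst) (MvPolynomial.pderiv s F) * (u s).snd := by
  classical
  induction F using MvPolynomial.induction_on with
  | C a => simp [TrivSqZeroExt.algebraMap_eq_inl]
  | add p q hp hq => simp [hp, hq, add_mul, Finset.sum_add_distrib]
  | mul_X p s hp =>
    refine ⟨by simp [hp], ?_⟩
    simp only [map_mul, MvPolynomial.aeval_X, DualNumber.snd_mul, hp, Derivation.leibniz,
      MvPolynomial.pderiv_X, smul_eq_mul, map_add, add_mul, Finset.sum_add_distrib,
      MvPolynomial.eval_X, Finset.sum_mul]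
    congr 1
    · rw [Finset.sum_eq_single s] <;> simp +contextual
    · exact Finset.sum_congr rfl fun _ _ => by ring

/-- The point `v + ε w` over the dual numbers. -/
def dualPoint {σ : Type} (v w : σ → ℂ) : σ → DualNumber ℂ :=
  fun s => TrivSqZeroExt.inl (v s) + TrivSqZeroExt.inr (w s)

/-- The tangent vectors are the `v` for which `x + ε v` satisfies the equations of `X`; the part
without `ε` is automatic as `x ∈ X`. -/
theorem mem_tangentSpaceAt_iff {σ : Type} [Fintype σ] {X : Set (PSpace σ)} {x : PSpace σ}
    (hx : x ∈ X) (v : σ → ℂ) :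
    v ∈ tangentSpaceAt X x ↔ ∀ (m : ℕ) (F : MvPolynomial σ ℂ), F.IsHomogeneous m →
      (∀ y ∈ X, MvPolynomial.eval y.coord F = 0) →
      MvPolynomial.aeval (dualPoint x.coord v) F = 0 := by
  refine forall₄_congr fun m F hF h0 => ?_
  have h := fst_snd_aeval (dualPoint x.coord v) F
  simp only [dualPoint, TrivSqZeroExt.fst_add, TrivSqZeroExt.fst_inl, TrivSqZeroExt.fst_inr,
    add_zero, TrivSqZeroExt.snd_add, TrivSqZeroExt.snd_inl, TrivSqZeroExt.snd_inr, zero_add] at h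
  constructor
  · intro hv
    ext
    · exact h.1.trans (h0 x hx)
    · exact h.2.trans hv
  · intro hv
    refine h.2.symm.trans ?_
    exact congrArg TrivSqZeroExt.snd hv

section

variable {r : ℕ} {n d : Fin r → ℕ}

/-- The form with coefficients `a` and its differential vanish at `y`. -/
def IsCritical (a : SVIndex n d → ℂ) (y : (i : Fin r) → Fin (n i + 1) → ℂ) : Prop :=
  ∀ Z : (i : Fin r) → Fin (n i + 1) → DualNumber ℂ, (∀ i k, (Z i k).fst = y i k) → svForm a Z = 0

theorem IsCritical.mul {a : SVIndex n d → ℂ} {y : (i : Fin r) → Fin (n i + 1) → ℂ}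
    (h : IsCritical a y) {c : Fin r → ℂ} (hc : ∀ i, c i ≠ 0) :
    IsCritical a (fun i k => c i * y i k) := by
  intro Z hZ
  have h1 := h (fun i k => TrivSqZeroExt.inl (c i)⁻¹ * Z i k) (fun i k => by
    simp [hZ, hc i])
  have h2 : Z = fun i k => TrivSqZeroExt.inl (c i) * (TrivSqZeroExt.inl (c i)⁻¹ * Z i k) := by
    funext i k
    rw [← mul_assoc, ← TrivSqZeroExt.inl_mul, mul_inv_cancel₀ (hc i), TrivSqZeroExt.inl_one, one_mul]
  rw [h2, svForm_mul, h1, mul_zero]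

theorem IsCritical.of_smul {a : SVIndex n d → ℂ} {y : (i : Fin r) → Fin (n i + 1) → ℂ} {c : ℂ}
    (hc : c ≠ 0) (h : IsCritical (c • a) y) : IsCritical a y := by
  intro Z hZ
  have h1 := h Z hZ
  rw [svForm_smul] at h1
  have h2 : algebraMap ℂ (DualNumber ℂ) c⁻¹ * (algebraMap ℂ (DualNumber ℂ) c * svForm a Z) = 0 := by
    rw [h1, mul_zero]
  rwa [← mul_assoc, ← map_mul, inv_mul_cancel₀ hc, map_one, one_mul] at h2

/-- The forms that are critical at a point. -/
def criticalForms (d : Fin r → ℕ) (y : (i : Fin r) → Fin (n i + 1) → ℂ) :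
    Submodule ℂ (SVIndex n d → ℂ) where
  carrier := {a | IsCritical a y}
  add_mem' := by
    intro a b ha hb Z hZ
    rw [svForm_add, ha Z hZ, hb Z hZ, add_zero]
  zero_mem' := fun Z _ => svForm_zero Z
  smul_mem' := by
    intro c a ha Z hZ
    rw [svForm_smul, ha Z hZ, mul_zero]

theorem IsCritical.svForm_eq_zero {a : SVIndex n d → ℂ} {y : (i : Fin r) → Fin (n i + 1) → ℂ}
    (h : IsCritical a y) : svForm a y = 0 := by
  have h1 := h (fun i k => TrivSqZeroExt.inl (y i k)) (fun i k => rfl)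
  have h2 := map_svForm (TrivSqZeroExt.fstHom ℂ ℂ ℂ) a
    (fun i k => (TrivSqZeroExt.inl (y i k) : DualNumber ℂ))
  rw [h1, map_zero] at h2
  exact h2.symm

theorem svVec_mul (c : Fin r → ℂ) (y : (i : Fin r) → Fin (n i + 1) → ℂ) :
    svVec n d (fun i k => c i * y i k) = (∏ i, c i ^ d i) • svVec n d y :=
  funext fun J => svMonomial_mul c y J

end

/-! ### Points and tangent spaces of the Segre-Veronese variety -/

section

variable {r : ℕ} {n d : Fin (r + 1) → ℕ}

theorem mem_segreVeronese_of_isCoord {x : PSpace (SVIndex n d)}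
    {y : (i : Fin (r + 1)) → Fin (n i + 1) → ℂ} (hy : ∀ i, y i ≠ 0) (h : IsCoord x (svVec n d y)) :
    x ∈ segreVeronese n d := by
  have h0 := svVec_ne_zero n d y hy
  have h1 : PSpace.mk _ h0 ∈ segreVeronese n d := by
    refine ⟨fun i => PSpace.mk (y i) (hy i), ?_⟩
    have h : ∀ i, IsCoord (PSpace.mk (y i) (hy i)) (y i) := fun i => isCoord_mk _ _
    choose c hc h using h
    have h2 := isCoord_mk _ (svVec_ne_zero n d (fun i => (PSpace.mk (y i) (hy i)).coord)
      fun i => PSpace.coord_ne_zero _)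
    refine h2.eq ?_
    simp only [h]
    refine (svVec_mul c y).symm ▸ ?_
    exact (isCoord_mk _ _).smul (Finset.prod_ne_zero_iff.mpr fun i _ => pow_ne_zero _ (hc i))
  rwa [h.eq (isCoord_mk _ h0)]

/-- The points of the Segre-Veronese variety. -/
theorem mem_segreVeronese_iff (hd : ∀ i, 0 < d i) (x : PSpace (SVIndex n d)) :
    x ∈ segreVeronese n d ↔
      ∃ y : (i : Fin (r + 1)) → Fin (n i + 1) → ℂ, (∀ i, y i ≠ 0) ∧ x.coord = svVec n d y := by
  constructor
  · rintro ⟨y, rfl⟩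
    obtain ⟨c, hc, h⟩ := isCoord_mk _ (svVec_ne_zero n d _ fun i => (y i).coord_ne_zero)
    -- The chosen representative is `c` times the vector of monomials; a root of `c` of order `d 0`,
    -- placed in factor `0`, absorbs the scalar.
    obtain ⟨b, hb⟩ := IsAlgClosed.exists_pow_nat_eq c (hd 0)
    have hb0 : b ≠ 0 := by
      rintro rfl
      rw [zero_pow (hd 0).ne'] at hb
      exact hc hb.symm
    refine ⟨fun i k => (if i = 0 then b else 1) * (y i).coord k, fun i h0 => ?_, ?_⟩
    · apply (y i).coord_ne_zero
      funext k
      have : (if i = 0 then b else 1) * (y i).coord k = 0 := congrFun h0 k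
      split_ifs at this
      · simpa [hb0] using this
      · simpa using this
    · rw [svVec_mul (fun i => if i = 0 then b else 1)]
      refine h.trans ?_
      congr 1
      rw [Finset.prod_eq_single 0] <;> simp +contextual [hb]
  · rintro ⟨y, hy, hx⟩
    exact mem_segreVeronese_of_isCoord hy (hx ▸ isCoord_coord x)

/-- A polynomial that vanishes on the Segre-Veronese variety vanishes at its points over any
`ℂ`-algebra. -/
theorem aeval_svMonomial_eq_zero {m : ℕ} {F : MvPolynomial (SVIndex n d) ℂ}
    (hF : F.IsHomogeneous m) (h0 : ∀ x ∈ segreVeronese n d, MvPolynomial.eval x.coord F = 0)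
    {R : Type} [CommRing R] [Algebra ℂ R] (z : (i : Fin (r + 1)) → Fin (n i + 1) → R) :
    MvPolynomial.aeval (svMonomial (d := d) z) F = 0 := by
  let T := MvPolynomial (Σ i : Fin (r + 1), Fin (n i + 1)) ℂ
  let ξ : (i : Fin (r + 1)) → Fin (n i + 1) → T := fun i k => MvPolynomial.X ⟨i, k⟩
  have hmap : ∀ {S : Type} [CommRing S] [Algebra ℂ S] (f : T →ₐ[ℂ] S),
      f (MvPolynomial.aeval (svMonomial (d := d) ξ) F) =
        MvPolynomial.aeval (svMonomial (d := d) fun i k => f (ξ i k)) F := by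
    intro S _ _ f
    rw [← AlgHom.comp_apply, MvPolynomial.comp_aeval]
    congr 2
    funext J
    exact map_svMonomial f ξ J
  -- The identity is proved for the universal point `ξ` by testing complex values. Those with a zero
  -- vector in some factor give no point of the variety; the extra product vanishes there, and it
  -- cancels afterwards in the polynomial ring.
  have hzero : (∏ i, ξ i 0) * MvPolynomial.aeval (svMonomial (d := d) ξ) F = 0 := by
    refine MvPolynomial.funext fun u => ?_
    rw [map_mul, map_zero, map_prod]
    by_cases hu : ∀ i, u ⟨i, 0⟩ ≠ 0
    · refine mul_eq_zero_of_right _ ?_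
      refine (hmap (MvPolynomial.aeval u)).trans ?_
      have hy : ∀ i : Fin (r + 1), (fun k : Fin (n i + 1) => u ⟨i, k⟩) ≠ 0 := fun i h =>
        hu i (congrFun h 0)
      have h1 := isCoord_mk _ (svVec_ne_zero n d _ hy)
      have h2 := h0 _ (mem_segreVeronese_of_isCoord hy h1)
      obtain ⟨c, hc, h1⟩ := h1
      rw [h1, hF.eval_smul_eq] at h2
      have h3 : (fun (i : Fin (r + 1)) (k : Fin (n i + 1)) => MvPolynomial.aeval u (ξ i k)) =
          fun i k => u ⟨i, k⟩ := by
        funext i k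
        exact MvPolynomial.aeval_X _ _
      rw [h3]
      exact (mul_eq_zero.mp h2).resolve_left (pow_ne_zero _ hc)
    · push Not at hu
      obtain ⟨i, hi⟩ := hu
      exact mul_eq_zero_of_left (Finset.prod_eq_zero (Finset.mem_univ i) (by simpa [ξ] using hi)) _
  have h1 := (mul_eq_zero.mp hzero).resolve_left
    (Finset.prod_ne_zero_iff.mpr fun i _ => MvPolynomial.X_ne_zero _)
  have h2 := hmap (MvPolynomial.aeval fun p => z p.1 p.2)
  rw [h1, map_zero] at h2
  have h3 : (fun (i : Fin (r + 1)) (k : Fin (n i + 1)) =>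
      MvPolynomial.aeval (fun p : Σ i : Fin (r + 1), Fin (n i + 1) => z p.1 p.2) (ξ i k)) = z := by
    funext i k
    exact MvPolynomial.aeval_X _ _
  rw [h3] at h2
  exact h2.symm

/-- The index obtained from a constant choice of variables by changing one slot of group `i`. -/
def slotIndexUpdate (k : (i : Fin (r + 1)) → Fin (n i + 1)) (i : Fin (r + 1)) (b : Fin (n i + 1)) :
    SVIndex n d :=
  slotIndex (Function.update (fun i' _ => k i') i fun s => if s.val = 0 then b else k i)

theorem prod_ite_val_eq_zero {R : Type} [CommRing R] {e : ℕ} (he : 0 < e) (b c : R) :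
    (∏ s : Fin e, if s.val = 0 then b else c) * c = b * c ^ e := by
  obtain ⟨e, rfl⟩ := Nat.exists_eq_add_of_lt he
  rw [zero_add, Fin.prod_univ_succ]
  simp
  ring

/-- Expresses the affine coordinate `z i b / z i (k i)` as a ratio of two ambient coordinates. It is
cleared of denominators in order to hold over every commutative ring. -/
theorem svMonomial_slotIndexUpdate_mul {R : Type} [CommRing R] (hd : ∀ i, 0 < d i)
    (z : (i : Fin (r + 1)) → Fin (n i + 1) → R) (k : (i : Fin (r + 1)) → Fin (n i + 1))
    (i : Fin (r + 1)) (b : Fin (n i + 1)) :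
    svMonomial z (slotIndexUpdate (d := d) k i b) * z i (k i) =
      z i b * svMonomial z (slotIndex (d := d) fun i _ => k i) := by
  rw [slotIndexUpdate, svMonomial_slotIndex, svMonomial_slotIndex,
    Fintype.prod_eq_mul_prod_compl i, Fintype.prod_eq_mul_prod_compl i (fun i => ∏ s, z i (k i))]
  have h1 : ∏ i' ∈ ({i} : Finset (Fin (r + 1)))ᶜ, ∏ s : Fin (d i'), z i' (Function.update
      (fun i' (_ : Fin (d i')) => k i') i (fun s => if s.val = 0 then b else k i) i' s) =
      ∏ i' ∈ ({i} : Finset (Fin (r + 1)))ᶜ, ∏ _s : Fin (d i'), z i' (k i') :=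
    Finset.prod_congr rfl fun i' hi' => by
      rw [Function.update_of_ne (by simpa using hi')]
  rw [h1, Function.update_self]
  have h2 := prod_ite_val_eq_zero (hd i) (z i b) (z i (k i))
  simp only [apply_ite (z i), Finset.prod_const, Finset.card_univ, Fintype.card_fin]
  linear_combination (∏ i' ∈ ({i} : Finset (Fin (r + 1)))ᶜ, z i' (k i') ^ d i') * h2

/-- Both sides are homogeneous of degree `∑ i, d i + 1` in the ambient coordinates. This gives
equations of the variety that determine all coordinates from those with at most one changed slot,
where the base coordinate is invertible. -/
theorem prod_svMonomial_slotIndexUpdate {R : Type} [CommRing R] [IsDomain R] (hd : ∀ i, 0 < d i)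
    (z : (i : Fin (r + 1)) → Fin (n i + 1) → R) (k : (i : Fin (r + 1)) → Fin (n i + 1))
    (φ : (i : Fin (r + 1)) → Fin (d i) → Fin (n i + 1)) :
    (∏ i, ∏ s, svMonomial z (slotIndexUpdate (d := d) k i (φ i s))) *
        svMonomial z (slotIndex (d := d) fun i _ => k i) =
      svMonomial z (slotIndex φ) * svMonomial z (slotIndex (d := d) fun i _ => k i) ^ ∑ i, d i := by
  conv_lhs => rw [svMonomial_slotIndex z (fun i _ => k i)]
  rw [← Finset.prod_mul_distrib, svMonomial_slotIndex z φ, ← Finset.prod_pow_eq_pow_sum,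
    ← Finset.prod_mul_distrib]
  refine Finset.prod_congr rfl fun i _ => ?_
  rw [← Finset.prod_mul_distrib]
  simp only [svMonomial_slotIndexUpdate_mul hd, Finset.prod_mul_distrib, Finset.prod_const,
    Finset.card_univ, Fintype.card_fin]

/-- This is Euler's identity. -/
theorem coord_mem_tangentSpaceAt {σ : Type} [Fintype σ] {X : Set (PSpace σ)} {x : PSpace σ}
    (hx : x ∈ X) : x.coord ∈ tangentSpaceAt X x := by
  intro m F hF h0
  have h := congrArg (MvPolynomial.eval x.coord) hF.sum_X_mul_pderiv
  simp only [map_sum, map_mul, MvPolynomial.eval_X, map_nsmul, h0 x hx, smul_zero] at h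
  rw [← h]
  exact Finset.sum_congr rfl fun _ _ => mul_comm _ _

/-- The hyperplane `a` is tangent to the Segre-Veronese variety at the image of `y` if and only if
the form with coefficients `a` is critical at `y`. -/
theorem tangentSpaceAt_le_hyperplane_iff (hd : ∀ i, 0 < d i) {x a : PSpace (SVIndex n d)}
    {y : (i : Fin (r + 1)) → Fin (n i + 1) → ℂ} (hy : ∀ i, y i ≠ 0) (hx : x.coord = svVec n d y) :
    tangentSpaceAt (segreVeronese n d) x ≤ hyperplane a ↔ IsCritical a.coord y := by
  have hxX : x ∈ segreVeronese n d := (mem_segreVeronese_iff hd x).mpr ⟨y, hy, hx⟩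
  constructor
  · intro h Z hZ
    have hfst : ∀ J, (svMonomial Z J : DualNumber ℂ).fst = svVec n d y J := fun J => by
      have := map_svMonomial (TrivSqZeroExt.fstHom ℂ ℂ ℂ) Z J
      simp only [TrivSqZeroExt.fstHom_apply, hZ] at this
      exact this
    -- The monomials of a lift `Z` of `y` form a point `x + ε v` of the cone over the dual numbers,
    -- so `v` is a tangent vector and lies in the hyperplane.
    let v : SVIndex n d → ℂ := fun J => (svMonomial Z J).snd
    have hpt : dualPoint x.coord v = svMonomial Z := by
      funext J
      ext
      · simp [dualPoint, hfst, hx]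
      · simp [dualPoint, v]
    have hv : v ∈ tangentSpaceAt (segreVeronese n d) x := by
      rw [mem_tangentSpaceAt_iff hxX]
      intro m F hF h0
      rw [hpt]
      exact aeval_svMonomial_eq_zero hF h0 Z
    have hav : ∑ J, a.coord J * v J = 0 := h hv
    have hax : ∑ J, a.coord J * x.coord J = 0 := h (coord_mem_tangentSpaceAt hxX)
    ext
    · simp only [svForm, TrivSqZeroExt.fst_sum, TrivSqZeroExt.algebraMap_eq_inl, TrivSqZeroExt.fst_mul,
        TrivSqZeroExt.fst_inl, hfst, TrivSqZeroExt.fst_zero, ← hx]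
      exact hax
    · simp only [svForm, TrivSqZeroExt.snd_sum, TrivSqZeroExt.algebraMap_eq_inl, DualNumber.snd_mul,
        TrivSqZeroExt.fst_inl, TrivSqZeroExt.snd_inl, TrivSqZeroExt.snd_zero, zero_mul, add_zero]
      exact hav
  · intro h v hv
    rw [mem_tangentSpaceAt_iff hxX] at hv
    have hk : ∀ i, ∃ k, y i k ≠ 0 := fun i => Function.ne_iff.mp (hy i)
    choose k hk using hk
    let u := dualPoint x.coord v
    let J₀ : SVIndex n d := slotIndex fun i _ => k i
    -- Conversely, a lift is rebuilt from the point `u = x + ε v`. It lies over a rescaling of `y`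
    -- in each factor, by `svVec n d y J₀ / y i (k i)`, at which the form is still critical.
    let Z : (i : Fin (r + 1)) → Fin (n i + 1) → DualNumber ℂ := fun i b =>
      u (slotIndexUpdate k i b)
    have hufst : ∀ J, (u J).fst = svVec n d y J := fun J => by simp [u, dualPoint, hx]
    have hq : svVec n d y J₀ ≠ 0 := by
      rw [svVec_eq_svMonomial, svMonomial_slotIndex]
      exact Finset.prod_ne_zero_iff.mpr fun i _ => Finset.prod_ne_zero_iff.mpr fun _ _ => hk i
    have hu₀ : IsUnit (u J₀) := by
      rw [TrivSqZeroExt.isUnit_iff_isUnit_fst, hufst]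
      exact isUnit_iff_ne_zero.mpr hq
    have hZ : svForm a.coord Z = 0 := by
      refine (h.mul (c := fun i => svVec n d y J₀ / y i (k i)) fun i => div_ne_zero hq (hk i)) Z
        fun i b => ?_
      have := svMonomial_slotIndexUpdate_mul (d := d) hd y k i b
      rw [← svVec_eq_svMonomial] at this
      simp only [Z, hufst]
      rw [div_mul_eq_mul_div, eq_div_iff (hk i), this, mul_comm]
    -- The equations from `prod_svMonomial_slotIndexUpdate` hold at `u` because `v` is tangent. They
    -- transfer the vanishing of the form at `Z` to `u`, since `u J₀` is a unit.
    have hu : ∀ J, u J * u J₀ ^ (∑ i, d i) = svMonomial Z J * u J₀ := fun J => by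
      obtain ⟨φ, rfl⟩ := slotIndex_surjective J
      let A : MvPolynomial (SVIndex n d) ℂ := (∏ i, ∏ s, MvPolynomial.X (slotIndexUpdate k i (φ i s))) *
        MvPolynomial.X J₀
      let B : MvPolynomial (SVIndex n d) ℂ := MvPolynomial.X (slotIndex φ) *
        MvPolynomial.X J₀ ^ ∑ i, d i
      have hA : A.IsHomogeneous (∑ i, d i + 1) := by
        refine MvPolynomial.IsHomogeneous.mul ?_ (MvPolynomial.isHomogeneous_X _ _)
        refine MvPolynomial.IsHomogeneous.prod _ _ _ fun i _ => ?_
        have := MvPolynomial.IsHomogeneous.prod Finset.univ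
          (fun s => (MvPolynomial.X (slotIndexUpdate k i (φ i s)) : MvPolynomial (SVIndex n d) ℂ))
          (fun _ => 1) fun s _ => MvPolynomial.isHomogeneous_X _ _
        simpa using this
      have hB : B.IsHomogeneous (∑ i, d i + 1) := by
        rw [add_comm (∑ i, d i) 1]
        refine MvPolynomial.IsHomogeneous.mul (MvPolynomial.isHomogeneous_X _ _) ?_
        exact MvPolynomial.isHomogeneous_X_pow _ _
      have h1 := hv _ (A - B) (hA.sub hB) fun x' hx' => by
        obtain ⟨y', -, hy'⟩ := (mem_segreVeronese_iff hd x').mp hx'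
        have := prod_svMonomial_slotIndexUpdate (d := d) hd y' k φ
        simp only [A, B, map_sub, map_mul, map_pow, map_prod, MvPolynomial.eval_X, hy',
          svVec_eq_svMonomial]
        exact sub_eq_zero.mpr this
      simp only [A, B, map_sub, map_mul, map_pow, map_prod, MvPolynomial.aeval_X] at h1
      rw [svMonomial_slotIndex]
      exact (sub_eq_zero.mp h1).symm
    have h2 : (∑ J, algebraMap ℂ (DualNumber ℂ) (a.coord J) * u J) * u J₀ ^ (∑ i, d i) = 0 := by
      rw [Finset.sum_mul]
      simp only [mul_assoc, hu]
      simp only [← mul_assoc]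
      rw [← Finset.sum_mul]
      exact mul_eq_zero_of_left hZ _
    have h3 := congrArg TrivSqZeroExt.snd ((hu₀.pow _).mul_left_eq_zero.mp h2)
    simp only [TrivSqZeroExt.snd_sum, TrivSqZeroExt.algebraMap_eq_inl, DualNumber.snd_mul,
      TrivSqZeroExt.fst_inl, TrivSqZeroExt.snd_inl, TrivSqZeroExt.snd_zero, zero_mul, add_zero] at h3
    refine Eq.trans ?_ h3
    simp [u, dualPoint]

end

/-! ### Nondegenerate critical points are isolated -/

/-- Hadamard's lemma at the origin; the values of the `q v` at `0` are the first derivatives of `p`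
there. -/
theorem MvPolynomial.exists_eq_add_sum_X_mul {κ : Type} [Fintype κ] (p : MvPolynomial κ ℂ) :
    ∃ q : κ → MvPolynomial κ ℂ, p = C (eval 0 p) + ∑ v, X v * q v := by
  classical
  induction p using MvPolynomial.induction_on with
  | C a => exact ⟨0, by simp⟩
  | add p p' hp hp' =>
    obtain ⟨q, hq⟩ := hp
    obtain ⟨q', hq'⟩ := hp'
    refine ⟨q + q', ?_⟩
    conv_lhs => rw [hq, hq']
    simp only [map_add, Pi.add_apply, mul_add, Finset.sum_add_distrib]
    ring
  | mul_X p w hp =>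
    refine ⟨Pi.single w p, ?_⟩
    rw [Finset.sum_eq_single w] <;> simp +contextual [mul_comm]

/-- A nondegenerate critical point of a polynomial is the only critical point in a Zariski
neighbourhood. -/
theorem MvPolynomial.exists_critical_eq_zero {κ : Type} [Fintype κ] [DecidableEq κ]
    (p : MvPolynomial κ ℂ) (h0 : ∀ v, eval 0 (pderiv v p) = 0)
    (hdet : (Matrix.of fun v w => eval 0 (pderiv w (pderiv v p))).det ≠ 0) :
    ∃ s : MvPolynomial κ ℂ, eval 0 s ≠ 0 ∧
      ∀ u, (∀ v, eval u (pderiv v p) = 0) → eval u s ≠ 0 → u = 0 := by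
  choose q hq using fun v => MvPolynomial.exists_eq_add_sum_X_mul (pderiv v p)
  have hev : ∀ (u : κ → ℂ), eval u (Matrix.of fun v w => q v w).det =
      (Matrix.of fun v w => eval u (q v w)).det := fun u => by
    rw [RingHom.map_det]
    rfl
  -- The gradient vanishes at `0`, so it equals `Q(u) u` with `Q = (q v w)`, and `Q(0)` is the
  -- Hessian. Where `det Q(u) ≠ 0`, a zero gradient forces `u = 0`.
  refine ⟨(Matrix.of fun v w => q v w).det, ?_, fun u hu hs => ?_⟩
  · rw [hev]
    convert hdet using 3
    ext v w
    conv_rhs => rw [hq v]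
    simp [pderiv_X, Pi.single_apply, apply_ite constantCoeff]
  · rw [hev] at hs
    refine Matrix.eq_zero_of_mulVec_eq_zero hs ?_
    funext v
    have h1 := hu v
    rw [hq v, h0] at h1
    simp only [map_add, eval_C, map_sum, map_mul, eval_X, zero_add] at h1
    simp only [Matrix.mulVec, dotProduct, Matrix.of_apply, Pi.zero_apply]
    rw [← h1]
    exact Finset.sum_congr rfl fun _ _ => mul_comm _ _

/-- Turns a Zariski open condition on the chart `L₀ ≠ 0` into a homogeneous one on projective space.
The exponent `m` need only be large enough to clear denominators. -/
theorem MvPolynomial.exists_homogenization {κ σ : Type} (L₀ : MvPolynomial σ ℂ)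
    (L : κ → MvPolynomial σ ℂ) (h₀ : L₀.IsHomogeneous 1) (h : ∀ v, (L v).IsHomogeneous 1)
    (s : MvPolynomial κ ℂ) :
    ∃ (m : ℕ) (P : MvPolynomial σ ℂ), P.IsHomogeneous m ∧ ∀ x, eval x L₀ ≠ 0 →
      eval x P = eval x L₀ ^ m * eval (fun v => eval x (L v) / eval x L₀) s := by
  induction s using MvPolynomial.induction_on with
  | C a => exact ⟨0, C a, isHomogeneous_C _ _, by simp⟩
  | add p q hp hq =>
    obtain ⟨m, P, hP, hp⟩ := hp
    obtain ⟨m', P', hP', hq⟩ := hq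
    refine ⟨m + m', L₀ ^ m' * P + L₀ ^ m * P', ?_, fun x hx => ?_⟩
    · refine IsHomogeneous.add ?_ ?_
      · have := (h₀.pow m').mul hP
        rwa [one_mul, add_comm] at this
      · have := (h₀.pow m).mul hP'
        rwa [one_mul] at this
    · simp only [map_add, map_mul, map_pow, hp x hx, hq x hx]
      ring
  | mul_X p v hp =>
    obtain ⟨m, P, hP, hp⟩ := hp
    refine ⟨m + 1, P * L v, hP.mul (h v), fun x hx => ?_⟩
    simp only [map_mul, hp x hx, eval_X]
    field_simp
    ring

/-! ### Affine charts and Hessians of forms -/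

section

variable {r : ℕ} {n : Fin r → ℕ}

/-- The coordinates on the chart where the coordinates `j i` are not zero. -/
abbrev ChartVar (j : (i : Fin r) → Fin (n i + 1)) : Type :=
  {v : Σ i : Fin r, Fin (n i + 1) // v.2 ≠ j v.1}

/-- The point with given coordinates in a chart. -/
def chartPoint {R : Type} [CommRing R] (j : (i : Fin r) → Fin (n i + 1)) (u : ChartVar j → R) :
    (i : Fin r) → Fin (n i + 1) → R :=
  fun i k => if h : k = j i then 1 else u ⟨⟨i, k⟩, h⟩

theorem map_chartPoint {R S : Type} [CommRing R] [CommRing S] [Algebra ℂ R] [Algebra ℂ S]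
    (f : R →ₐ[ℂ] S) (j : (i : Fin r) → Fin (n i + 1)) (u : ChartVar j → R) (i : Fin r)
    (k : Fin (n i + 1)) : f (chartPoint j u i k) = chartPoint j (fun v => f (u v)) i k := by
  unfold chartPoint
  split_ifs <;> simp

variable {d : Fin r → ℕ}

/-- The form with coefficients `a`, in the coordinates of a chart after a linear substitution. -/
def chartForm (g : (i : Fin r) → Matrix (Fin (n i + 1)) (Fin (n i + 1)) ℂ)
    (j : (i : Fin r) → Fin (n i + 1)) (a : SVIndex n d → ℂ) : MvPolynomial (ChartVar j) ℂ :=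
  svForm a (linearSubst g (chartPoint j MvPolynomial.X))

/-- The Hessian matrix of a form at the origin of a chart. -/
def chartHessian (g : (i : Fin r) → Matrix (Fin (n i + 1)) (Fin (n i + 1)) ℂ)
    (j : (i : Fin r) → Fin (n i + 1)) (a : SVIndex n d → ℂ) :
    Matrix (ChartVar j) (ChartVar j) ℂ :=
  Matrix.of fun v w =>
    MvPolynomial.eval 0 (MvPolynomial.pderiv w (MvPolynomial.pderiv v (chartForm g j a)))

theorem aeval_chartForm {R : Type} [CommRing R] [Algebra ℂ R]
    (g : (i : Fin r) → Matrix (Fin (n i + 1)) (Fin (n i + 1)) ℂ)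
    (j : (i : Fin r) → Fin (n i + 1)) (a : SVIndex n d → ℂ) (u : ChartVar j → R) :
    MvPolynomial.aeval u (chartForm g j a) = svForm a (linearSubst g (chartPoint j u)) := by
  rw [chartForm, map_svForm]
  congr 1
  funext i m
  rw [map_linearSubst]
  congr 1
  funext i k
  rw [map_chartPoint]
  simp

/-- Moving `u` by `ε` in the direction `v` gives a lift of the chart point to the dual numbers, on
which the form vanishes; the partial derivative is its `ε`-coefficient. -/
theorem IsCritical.eval_pderiv_chartForm
    {g : (i : Fin r) → Matrix (Fin (n i + 1)) (Fin (n i + 1)) ℂ}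
    {j : (i : Fin r) → Fin (n i + 1)} {a : SVIndex n d → ℂ} {u : ChartVar j → ℂ}
    (h : IsCritical a (linearSubst g (chartPoint j u))) (v : ChartVar j) :
    MvPolynomial.eval u (MvPolynomial.pderiv v (chartForm g j a)) = 0 := by
  have h1 := aeval_chartForm g j a (dualPoint u (Pi.single v 1))
  have hfst : ∀ w, (dualPoint u (Pi.single v 1) w).fst = u w := fun w => by simp [dualPoint]
  have hsnd : ∀ w, (dualPoint u (Pi.single v 1) w).snd = (Pi.single v 1 : ChartVar j → ℂ) w :=
    fun w => by simp [dualPoint]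
  rw [h _ fun i k => by
    have h2 := map_linearSubst (TrivSqZeroExt.fstHom ℂ ℂ ℂ) g
      (chartPoint j (dualPoint u (Pi.single v 1))) i k
    have h3 : (fun i k => (TrivSqZeroExt.fstHom ℂ ℂ ℂ)
        (chartPoint j (dualPoint u (Pi.single v 1)) i k)) = chartPoint j u := by
      funext i k
      rw [map_chartPoint]
      simp only [TrivSqZeroExt.fstHom_apply, hfst]
    rw [h3] at h2
    exact h2] at h1
  have h3 := (fst_snd_aeval (dualPoint u (Pi.single v 1)) (chartForm g j a)).2
  rw [h1] at h3
  simp only [hfst, hsnd, TrivSqZeroExt.snd_zero] at h3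
  rw [Finset.sum_eq_single v] at h3
  · simpa using h3.symm
  · intro w _ hw
    simp [hw]
  · simp

/-- Linear changes in the factors act linearly on the ambient space, so each monomial in `z` is a
linear form in the monomials of `g z`. -/
theorem exists_isHomogeneous_eval_eq_svMonomial
    {g : (i : Fin r) → Matrix (Fin (n i + 1)) (Fin (n i + 1)) ℂ}
    (hg : ∀ i, (g i).det ≠ 0) (J : SVIndex n d) :
    ∃ L : MvPolynomial (SVIndex n d) ℂ, L.IsHomogeneous 1 ∧
      ∀ z : (i : Fin r) → Fin (n i + 1) → ℂ,
        MvPolynomial.eval (svVec n d (linearSubst g z)) L = svMonomial z J := by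
  classical
  obtain ⟨a, ha⟩ := exists_svForm_eq_linearSubst (Pi.single J 1) (fun i => (g i)⁻¹)
  refine ⟨∑ J, MvPolynomial.C (a J) * MvPolynomial.X J, ?_, fun z => ?_⟩
  · exact MvPolynomial.IsHomogeneous.sum _ _ _ fun J _ => MvPolynomial.isHomogeneous_C_mul_X _ _
  · have h1 := ha ℂ (linearSubst g z)
    rw [linearSubst_inv' hg, svForm_single] at h1
    rw [← h1, svForm_complex]
    simp

end

section

variable {r : ℕ} {n d : Fin (r + 1) → ℕ}

theorem linearSubst_const_mul {R : Type} [CommRing R] [Algebra ℂ R]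
    (g : (i : Fin (r + 1)) → Matrix (Fin (n i + 1)) (Fin (n i + 1)) ℂ)
    (c : Fin (r + 1) → R) (z : (i : Fin (r + 1)) → Fin (n i + 1) → R) :
    linearSubst g (fun i k => c i * z i k) = fun i k => c i * linearSubst g z i k := by
  funext i k
  simp only [linearSubst, Finset.mul_sum]
  exact Finset.sum_congr rfl fun _ _ => by ring

/-- A nondegenerate singular point of a hyperplane section is isolated. -/
theorem exists_isOpen_singHyperplaneSection_eq (hd : ∀ i, 0 < d i)
    {g : (i : Fin (r + 1)) → Matrix (Fin (n i + 1)) (Fin (n i + 1)) ℂ}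
    (hg : ∀ i, (g i).det ≠ 0) (j : (i : Fin (r + 1)) → Fin (n i + 1))
    {x₀ a : PSpace (SVIndex n d)} (hx₀ : IsCoord x₀ (svVec n d (linearSubst g (chartPoint j 0))))
    {b : SVIndex n d → ℂ} (hb : IsCoord a b) (hcrit : IsCritical b (linearSubst g (chartPoint j 0)))
    (hdet : (chartHessian g j b).det ≠ 0) :
    ∃ U : Set (PSpace (SVIndex n d)), IsOpen U ∧ x₀ ∈ U ∧
      ∀ x ∈ singHyperplaneSection (segreVeronese n d) a, x ∈ U → x = x₀ := by
  obtain ⟨s, hs₀, hs⟩ := MvPolynomial.exists_critical_eq_zero (chartForm g j b)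
    (fun v => hcrit.eval_pderiv_chartForm v) hdet
  obtain ⟨L₀, hL₀, hL₀e⟩ := exists_isHomogeneous_eval_eq_svMonomial hg
    (slotIndex (d := d) fun i _ => j i)
  choose L hL hLe using fun v : ChartVar j => exists_isHomogeneous_eval_eq_svMonomial hg
    (slotIndexUpdate (d := d) j v.1.1 v.1.2)
  obtain ⟨m, P, hP, hPe⟩ := MvPolynomial.exists_homogenization L₀ L hL₀ hL s
  have hz₀ : ∀ z : (i : Fin (r + 1)) → Fin (n i + 1) → ℂ,
      MvPolynomial.eval (svVec n d (linearSubst g z)) L₀ ≠ 0 ↔ ∀ i, z i (j i) ≠ 0 := fun z => by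
    rw [hL₀e, svMonomial_slotIndex]
    simp [Finset.prod_ne_zero_iff, (hd _).ne']
  have hzP : ∀ z : (i : Fin (r + 1)) → Fin (n i + 1) → ℂ, (∀ i, z i (j i) ≠ 0) →
      (MvPolynomial.eval (svVec n d (linearSubst g z)) P ≠ 0 ↔
        MvPolynomial.eval (fun v : ChartVar j => z v.1.1 v.1.2 / z v.1.1 (j v.1.1)) s ≠ 0) := by
    intro z hz
    have h1 := (hz₀ z).mpr hz
    rw [hPe _ h1]
    have h2 : (fun v => MvPolynomial.eval (svVec n d (linearSubst g z)) (L v) /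
        MvPolynomial.eval (svVec n d (linearSubst g z)) L₀) =
        fun v : ChartVar j => z v.1.1 v.1.2 / z v.1.1 (j v.1.1) := by
      funext v
      rw [div_eq_div_iff h1 (hz _), hLe, hL₀e]
      exact svMonomial_slotIndexUpdate_mul hd z j v.1.1 v.1.2
    rw [h2, mul_ne_zero_iff]
    simp [h1]
  -- `L₀ ≠ 0` is the chart, and on it `P ≠ 0` is the locus `s ≠ 0` where the origin is the only
  -- critical point.
  have hopen := PSpace.isOpen_eval_ne_zero (hL₀.mul hP)
  refine ⟨_, hopen, ?_, fun x hx hxU => ?_⟩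
  · obtain ⟨c, hc, hx₀⟩ := hx₀
    rw [Set.mem_ofPred_eq, hx₀, (hL₀.mul hP).eval_smul_eq, map_mul]
    have h1 : ∀ i, chartPoint j (0 : ChartVar j → ℂ) i (j i) ≠ 0 := fun i => by simp [chartPoint]
    refine mul_ne_zero (pow_ne_zero _ hc) (mul_ne_zero ((hz₀ _).mpr h1) ((hzP _ h1).mpr ?_))
    convert hs₀ using 3
    funext v
    simp [chartPoint, v.2]
  · obtain ⟨hxX, hxs⟩ := hx
    obtain ⟨y, hy, hxy⟩ := (mem_segreVeronese_iff hd x).mp hxX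
    rw [tangentSpaceAt_le_hyperplane_iff hd hy hxy] at hxs
    obtain ⟨c, hc, hb⟩ := hb
    rw [hb] at hxs
    replace hxs := hxs.of_smul hc
    obtain ⟨z, rfl⟩ : ∃ z, y = linearSubst g z := ⟨_, (linearSubst_inv hg y).symm⟩
    rw [Set.mem_ofPred_eq, map_mul, hxy] at hxU
    have hz := (hz₀ z).mp (left_ne_zero_of_mul hxU)
    have hsz := (hzP z hz).mp (right_ne_zero_of_mul hxU)
    set u : ChartVar j → ℂ := fun v => z v.1.1 v.1.2 / z v.1.1 (j v.1.1) with hu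
    have hzu : linearSubst g (chartPoint j u) = fun i k => (z i (j i))⁻¹ * linearSubst g z i k := by
      rw [← linearSubst_const_mul]
      congr 1
      funext i k
      unfold chartPoint
      split_ifs with h
      · subst h
        rw [inv_mul_cancel₀ (hz i)]
      · rw [hu]
        exact div_eq_inv_mul _ _
    have hcu : IsCritical b (linearSubst g (chartPoint j u)) := by
      rw [hzu]
      exact hxs.mul fun i => inv_ne_zero (hz i)
    have hu0 : u = 0 := hs u (fun v => hcu.eval_pderiv_chartForm v) hsz
    have h3 := (isCoord_coord x).smul (c := ∏ i, ((z i (j i))⁻¹) ^ d i)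
      (Finset.prod_ne_zero_iff.mpr fun i _ => pow_ne_zero _ (inv_ne_zero (hz i)))
    rw [hxy, ← svVec_mul, ← hzu, hu0] at h3
    exact h3.eq hx₀

end

/-! ### General tuples of points and general tangent hyperplanes -/

theorem topologicalKrullDim_le_zero_of_finite {Y : Type} [TopologicalSpace Y] [T1Space Y]
    {S : Set Y} (hS : S.Finite) : topologicalKrullDim S ≤ 0 := by
  have : Finite S := hS
  exact topologicalKrullDim_zero_of_discreteTopology S

/-- If `C` had a second point, the open sets `U` and `{x₀}ᶜ` would both meet `C`, hence meet
together inside it, against `h`. -/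
theorem IsIrreducible.subset_singleton_of_isOpen {Y : Type} [TopologicalSpace Y] [T1Space Y]
    {C U : Set Y} (hC : IsIrreducible C) (hU : IsOpen U) {x₀ : Y} (hx₀ : x₀ ∈ C) (hx₀U : x₀ ∈ U)
    (h : ∀ x ∈ C, x ∈ U → x = x₀) : C ⊆ {x₀} := by
  intro y hy
  by_contra hne
  obtain ⟨z, hzC, hzU, hz⟩ := hC.isPreirreducible U {x₀}ᶜ hU isOpen_compl_singleton ⟨x₀, hx₀, hx₀U⟩
    ⟨y, hy, hne⟩
  exact hz (h z hzC hzU)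

/-- A vector of a subspace can be moved so that finitely many polynomial functions do not vanish,
without leaving a given Zariski neighbourhood. -/
theorem exists_mem_forall_ne_zero {σ ι : Type} [Fintype σ] [Fintype ι]
    (W : Submodule ℂ (σ → ℂ)) (G : ι → (σ → ℂ) → ℂ)
    (hG : ∀ k v w, ∃ P : Polynomial ℂ, ∀ t, P.eval t = G k (v + t • w))
    (hne : ∀ k, ∃ w ∈ W, G k w ≠ 0) {V : Set (PSpace σ)} (hV : IsOpen V) {a₀ : PSpace σ}
    (ha₀ : a₀ ∈ V) (haW : a₀.coord ∈ W) :
    ∃ v ∈ W, v ≠ 0 ∧ (∀ k, G k v ≠ 0) ∧ ∀ x, IsCoord x v → x ∈ V := by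
  classical
  suffices h : ∀ s : Finset ι, ∃ v ∈ W, v ≠ 0 ∧ (∀ k ∈ s, G k v ≠ 0) ∧ ∀ x, IsCoord x v → x ∈ V by
    simpa using h Finset.univ
  intro s
  induction s using Finset.induction_on with
  | empty =>
    exact ⟨a₀.coord, haW, a₀.coord_ne_zero, by simp, fun x hx => hx.eq (isCoord_coord a₀) ▸ ha₀⟩
  | insert k s _ ih =>
    obtain ⟨v, hvW, hv, hvs, hvV⟩ := ih
    obtain ⟨w, hwW, hw⟩ := hne k
    -- On the line from `v` to `w`, the old conditions hold at `t = 0` and the new one at `t = 1`;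
    -- each then fails for only finitely many `t`.
    choose P hP using fun l => hG l v (w - v)
    obtain ⟨m, hm⟩ := Function.ne_iff.mp hv
    let Q : σ → Polynomial ℂ := fun m => Polynomial.C (v m) + Polynomial.X * Polynomial.C ((w - v) m)
    have hQ : ∀ t, (fun m => (Q m).eval t) = v + t • (w - v) := fun t => by
      funext m
      simp [Q]
    have e1 : ∀ᶠ t in Filter.cofinite, ∀ x, IsCoord x (fun m => (Q m).eval t) → x ∈ V := by
      refine PSpace.eventually_mem hV Q 0 (PSpace.mk v hv) (hvV _ (isCoord_mk v hv)) ?_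
      rw [hQ]
      simpa using isCoord_mk v hv
    have e2 : ∀ᶠ t in Filter.cofinite, (Q m).eval t ≠ 0 :=
      Polynomial.eventually_cofinite_eval_ne_zero (t₀ := 0) (by simpa [Q] using hm)
    have e3 : ∀ᶠ t in Filter.cofinite, (P k).eval t ≠ 0 :=
      Polynomial.eventually_cofinite_eval_ne_zero (t₀ := 1) (by simpa [hP] using hw)
    have e4 : ∀ᶠ t in Filter.cofinite, ∀ l ∈ s, (P l).eval t ≠ 0 := by
      rw [Filter.eventually_all_finset]
      intro l hl
      exact Polynomial.eventually_cofinite_eval_ne_zero (t₀ := 0) (by simpa [hP] using hvs l hl)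
    obtain ⟨t, ⟨⟨h1, h2⟩, h3⟩, h4⟩ := (((e1.and e2).and e3).and e4).exists
    rw [hQ] at h1
    refine ⟨v + t • (w - v), W.add_mem hvW (W.smul_mem t (W.sub_mem hwW hvW)), fun h0 => h2 ?_, ?_, h1⟩
    · rw [← hQ] at h0
      exact congrFun h0 m
    · intro l hl
      rw [← hP]
      rcases Finset.mem_insert.mp hl with rfl | hl
      · exact h3
      · exact h4 l hl

theorem exists_polynomial_eval_eq_det {κ : Type} [Fintype κ] [DecidableEq κ]
    (M N : Matrix κ κ ℂ) : ∃ P : Polynomial ℂ, ∀ t, P.eval t = (M + t • N).det := by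
  refine ⟨(Matrix.of fun v w => Polynomial.C (M v w) + Polynomial.X * Polynomial.C (N v w)).det,
    fun t => ?_⟩
  rw [← Polynomial.coe_evalRingHom, RingHom.map_det]
  congr 1
  ext v w
  simp
  ring

section

variable {r : ℕ} {n d : Fin r → ℕ}

theorem IsCritical.of_svForm_eq {a b : SVIndex n d → ℂ}
    {g : (i : Fin r) → Matrix (Fin (n i + 1)) (Fin (n i + 1)) ℂ}
    (h : ∀ (R : Type) [CommRing R] [Algebra ℂ R] (z : (i : Fin r) → Fin (n i + 1) → R),
      svForm a z = svForm b (linearSubst g z))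
    {y : (i : Fin r) → Fin (n i + 1) → ℂ} (hb : IsCritical b (linearSubst g y)) :
    IsCritical a y := by
  intro Z hZ
  rw [h]
  refine hb _ fun i k => ?_
  have h2 := map_linearSubst (TrivSqZeroExt.fstHom ℂ ℂ ℂ) g Z i k
  simp only [TrivSqZeroExt.fstHom_apply, hZ] at h2
  exact h2

theorem chartHessian_add_smul (g : (i : Fin r) → Matrix (Fin (n i + 1)) (Fin (n i + 1)) ℂ)
    (j : (i : Fin r) → Fin (n i + 1)) (a b : SVIndex n d → ℂ) (t : ℂ) :
    chartHessian g j (a + t • b) = chartHessian g j a + t • chartHessian g j b := by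
  ext v w
  simp [chartHessian, chartForm, svForm_add, svForm_smul, MvPolynomial.algebraMap_eq,
    Derivation.leibniz]

theorem linearSubst_chartPoint_zero (g : (i : Fin r) → Matrix (Fin (n i + 1)) (Fin (n i + 1)) ℂ)
    (j : (i : Fin r) → Fin (n i + 1)) :
    linearSubst g (chartPoint j (0 : ChartVar j → ℂ)) = fun i m => g i m (j i) := by
  funext i m
  simp [linearSubst, chartPoint]

theorem linearSubst_chartPoint_zero_ne_zero
    {g : (i : Fin r) → Matrix (Fin (n i + 1)) (Fin (n i + 1)) ℂ} (hg : ∀ i, (g i).det ≠ 0)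
    (j : (i : Fin r) → Fin (n i + 1)) (i : Fin r) :
    linearSubst g (chartPoint j (0 : ChartVar j → ℂ)) i ≠ 0 := by
  rw [linearSubst_chartPoint_zero]
  exact fun h => hg i (Matrix.det_eq_zero_of_column_eq_zero (j i) fun m => congrFun h m)

theorem isCritical_iff_of_isCoord {a : PSpace (SVIndex n d)} {b : SVIndex n d → ℂ}
    (h : IsCoord a b) (y : (i : Fin r) → Fin (n i + 1) → ℂ) :
    IsCritical a.coord y ↔ IsCritical b y := by
  obtain ⟨c, hc, h⟩ := h
  rw [h]
  exact ⟨IsCritical.of_smul hc, fun h => (criticalForms d y).smul_mem c h⟩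

end

section

variable {r : ℕ} {n d : Fin (r + 1) → ℕ}

theorem tangentSpaceAt_le_hyperplane_iff_of_isCoord (hd : ∀ i, 0 < d i)
    {x a : PSpace (SVIndex n d)} {y : (i : Fin (r + 1)) → Fin (n i + 1) → ℂ} (hy : ∀ i, y i ≠ 0)
    (hx : IsCoord x (svVec n d y)) :
    tangentSpaceAt (segreVeronese n d) x ≤ hyperplane a ↔ IsCritical a.coord y := by
  obtain ⟨c, hc, hx⟩ := hx
  obtain ⟨b, hb⟩ := IsAlgClosed.exists_pow_nat_eq c (hd 0)
  have hb0 : ∀ i : Fin (r + 1), (if i = 0 then b else 1) ≠ 0 := by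
    intro i
    split_ifs
    · rintro rfl
      rw [zero_pow (hd 0).ne'] at hb
      exact hc hb.symm
    · exact one_ne_zero
  have hprod : ∏ i, (if i = 0 then b else 1) ^ d i = c := by
    rw [Finset.prod_eq_single 0] <;> simp +contextual [hb]
  rw [← hprod, ← svVec_mul] at hx
  rw [tangentSpaceAt_le_hyperplane_iff hd _ hx]
  · refine ⟨fun h => ?_, fun h => h.mul hb0⟩
    have := h.mul fun i => inv_ne_zero (hb0 i)
    simpa only [inv_mul_cancel_left₀ (hb0 _)] using this
  · intro i h0
    apply hy i
    funext k
    exact (mul_eq_zero.mp (congrFun h0 k)).resolve_left (hb0 i)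

/-- The index `k`, in each factor. -/
def diagIndex (hn : ∀ i, n 0 ≤ n i) (k : Fin (n 0 + 1)) : (i : Fin (r + 1)) → Fin (n i + 1) :=
  fun i => k.castLE (Nat.succ_le_succ (hn i))

/-- A general tuple of at most `n 0 + 1` points consists, up to a linear change of coordinates in
each factor, of coordinate points. -/
theorem exists_mem_isCoord_linearSubst (hd : ∀ i, 0 < d i) (hn : ∀ i, n 0 ≤ n i)
    {U : Set (PTuple (n 0 + 1) (SVIndex n d))} (hU : IsOpen U)
    (hne : (tuplesIn (n 0 + 1) (segreVeronese n d) ∩ U).Nonempty) :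
    ∃ x ∈ U, ∃ g : (i : Fin (r + 1)) → Matrix (Fin (n i + 1)) (Fin (n i + 1)) ℂ,
      (∀ i, (g i).det ≠ 0) ∧ ∀ k : Fin (n 0 + 1), IsCoord (x k) (svVec n d
        (linearSubst g (chartPoint (diagIndex hn k) 0))) := by
  obtain ⟨x₀, hx₀, hx₀U⟩ := hne
  choose Y hY hxY using fun k => (mem_segreVeronese_iff hd (x₀ k)).mp (hx₀ k)
  -- The first `n 0 + 1` columns are the given points, the others are standard basis vectors. `B`
  -- may be singular, so `A` joins it (at `t = 0`) to the identity (at `t = 1`): for almost all `t`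
  -- the matrices are invertible and the tuple stays in `U`.
  let B : (i : Fin (r + 1)) → Matrix (Fin (n i + 1)) (Fin (n i + 1)) ℂ := fun i =>
    Matrix.of fun m c => if h : c.val < n 0 + 1 then Y ⟨c.val, h⟩ i m else if m = c then 1 else 0
  let A : (i : Fin (r + 1)) → Matrix (Fin (n i + 1)) (Fin (n i + 1)) (Polynomial ℂ) := fun i =>
    Matrix.of fun m c => (1 - Polynomial.X) * Polynomial.C (B i m c) +
      Polynomial.X * Polynomial.C (if m = c then 1 else 0)
  let g : ℂ → (i : Fin (r + 1)) → Matrix (Fin (n i + 1)) (Fin (n i + 1)) ℂ := fun t i =>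
    (A i).map (Polynomial.eval t)
  have hdet : ∀ t i, (A i).det.eval t = (g t i).det := fun t i => by
    rw [← Polynomial.coe_evalRingHom, RingHom.map_det]
    rfl
  let P : Fin (n 0 + 1) → SVIndex n d → Polynomial ℂ := fun k =>
    svMonomial fun i m => A i m (diagIndex hn k i)
  have hP : ∀ k t, (fun J => (P k J).eval t) = svVec n d
      (linearSubst (g t) (chartPoint (diagIndex hn k) 0)) := by
    intro k t
    rw [linearSubst_chartPoint_zero]
    funext J
    exact map_svMonomial (Polynomial.aeval t) _ J
  have e1 := PTuple.eventually_mem hU P 0 x₀ hx₀U fun k => by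
    rw [hP, linearSubst_chartPoint_zero]
    refine ⟨1, one_ne_zero, ?_⟩
    rw [hxY k, one_smul]
    congr 1
    funext i m
    simp [g, A, B, diagIndex, Nat.le_of_lt_succ k.2, apply_ite (Polynomial.eval (0 : ℂ))]
  have e2 : ∀ᶠ t in Filter.cofinite, ∀ i, (A i).det.eval t ≠ 0 := by
    rw [Filter.eventually_all]
    intro i
    refine Polynomial.eventually_cofinite_eval_ne_zero (t₀ := 1) ?_
    have h1 : g 1 i = 1 := by
      ext m c
      simp [g, A, Matrix.one_apply, apply_ite (Polynomial.eval (1 : ℂ))]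
    rw [hdet, h1, Matrix.det_one]
    exact one_ne_zero
  obtain ⟨t, h1, h2⟩ := (e1.and e2).exists
  have hg : ∀ i, (g t i).det ≠ 0 := fun i => hdet t i ▸ h2 i
  refine ⟨fun k => PSpace.mk _ (svVec_ne_zero n d _
    (linearSubst_chartPoint_zero_ne_zero hg (diagIndex hn k))), h1 _ fun k => ?_, g t, hg, fun k => ?_⟩
  · rw [hP]
    exact isCoord_mk _ _
  · exact isCoord_mk _ _

end

/-! ### The Hessian criterion -/

section

variable {r : ℕ} {n d : Fin (r + 1) → ℕ}

/-- If the coordinate points are nondegenerate critical points of suitable forms, then the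
Segre-Veronese variety is not weakly defective. -/
theorem not_isWeaklyDefective_of_chartHessian (hd : ∀ i, 0 < d i) (hn : ∀ i, n 0 ≤ n i)
    (H : ∀ b₀ : SVIndex n d → ℂ, b₀ ≠ 0 →
      (∀ l, IsCritical b₀ (chartPoint (diagIndex hn l) 0)) → ∀ k, ∃ b : SVIndex n d → ℂ,
        (∀ l, IsCritical b (chartPoint (diagIndex hn l) 0)) ∧
        (chartHessian (fun _ => 1) (diagIndex hn k) b).det ≠ 0) :
    ¬ IsWeaklyDefective (segreVeronese n d) (n 0 + 1) := by
  rintro ⟨U, hU, hne, hUx⟩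
  obtain ⟨x, hxU, g, hg, hx⟩ := exists_mem_isCoord_linearSubst hd hn hU hne
  have hy : ∀ (k : Fin (n 0 + 1)) i, linearSubst g (chartPoint (diagIndex hn k) 0) i ≠ 0 := fun k =>
    linearSubst_chartPoint_zero_ne_zero hg _
  have htan : ∀ a : PSpace (SVIndex n d), a ∈ tangentHyperplanes (segreVeronese n d) x ↔
      ∀ k, IsCritical a.coord (linearSubst g (chartPoint (diagIndex hn k) 0)) := by
    intro a
    change (⨆ k, tangentSpaceAt (segreVeronese n d) (x k)) ≤ hyperplane a ↔ _
    rw [iSup_le_iff]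
    refine forall_congr' fun k => ?_
    exact tangentSpaceAt_le_hyperplane_iff_of_isCoord hd (hy k) (hx k)
  obtain ⟨V, hV, ⟨a₀, ha₀, ha₀V⟩, hVa⟩ :=
    hUx x ⟨fun k => mem_segreVeronese_of_isCoord (hy k) (hx k), hxU⟩
  rw [htan] at ha₀
  -- Weak defectiveness supplies a tangent hyperplane `a₀`. In adapted coordinates it is a nonzero
  -- form critical at the coordinate points, the form that `H` takes as input.
  obtain ⟨b₀, hb₀⟩ := exists_svForm_eq_linearSubst a₀.coord g
  have hb₀ne : b₀ ≠ 0 := by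
    rintro rfl
    refine a₀.coord_ne_zero (eq_zero_of_svForm_eq_zero _ fun z => ?_)
    have := hb₀ ℂ (linearSubst (fun i => (g i)⁻¹) z)
    rw [linearSubst_inv hg, svForm_zero] at this
    exact this.symm
  replace H := H b₀ hb₀ne fun l => (ha₀ l).of_svForm_eq hb₀
  let W : Submodule ℂ (SVIndex n d → ℂ) :=
    ⨅ k, criticalForms d (linearSubst g (chartPoint (diagIndex hn k) 0))
  have hW : ∀ a, a ∈ W ↔ ∀ k, IsCritical a (linearSubst g (chartPoint (diagIndex hn k) 0)) :=
    fun a => Submodule.mem_iInf _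
  -- The Hessian determinants are polynomial along lines in the space `W` of critical forms, so a
  -- form for each point yields one form in `V` that works at all points.
  obtain ⟨v, hvW, hv, hvdet, hvV⟩ := exists_mem_forall_ne_zero W
    (fun k a => (chartHessian g (diagIndex hn k) a).det)
    (fun k v w => by
      simp only [chartHessian_add_smul]
      exact exists_polynomial_eval_eq_det _ _)
    (fun k => by
      obtain ⟨b, hb, hbdet⟩ := H k
      obtain ⟨a, ha⟩ := exists_svForm_eq_linearSubst b (fun i => (g i)⁻¹)
      refine ⟨a, (hW a).mpr fun l => ?_, ?_⟩
      · refine IsCritical.of_svForm_eq ha ?_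
        rw [linearSubst_inv' hg]
        exact hb l
      · have : chartForm g (diagIndex hn k) a = chartForm (fun _ => 1) (diagIndex hn k) b := by
          rw [chartForm, chartForm, ha, linearSubst_inv' hg, linearSubst_one]
        simp only [chartHessian, this]
        exact hbdet) hV ha₀V ((hW _).mpr ha₀)
  rw [hW] at hvW
  have hav := isCoord_mk v hv
  have ha : PSpace.mk v hv ∈ tangentHyperplanes (segreVeronese n d) x := by
    rw [htan]
    exact fun k => (isCritical_iff_of_isCoord hav _).mpr (hvW k)
  refine (hVa _ ⟨ha, hvV _ hav⟩).not_ge (topologicalKrullDim_le_zero_of_finite ?_)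
  -- Each component through some `x k` reduces to that point, so the contact locus is finite.
  refine (Set.finite_range x).subset ?_
  rintro y ⟨C, ⟨hC, k, hk⟩, hyC⟩
  change Maximal (fun D => IsIrreducible D ∧ D ⊆ singHyperplaneSection (segreVeronese n d) _) C at hC
  obtain ⟨N, hN, hxN, hNx⟩ := exists_isOpen_singHyperplaneSection_eq hd hg (diagIndex hn k) (hx k) hav
    (hvW k) (hvdet k)
  have hsub := hC.prop.1.subset_singleton_of_isOpen hN hk hxN fun z hz hzN =>
    hNx z (hC.prop.2 hz) hzN
  exact ⟨k, (hsub hyC).symm⟩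

/-- A monomial is critical at a point if two of its factors vanish there. -/
theorem isCritical_single {φ : (i : Fin (r + 1)) → Fin (d i) → Fin (n i + 1)}
    {y : (i : Fin (r + 1)) → Fin (n i + 1) → ℂ} {s t : Σ i, Fin (d i)} (hst : s ≠ t)
    (hs : y s.1 (φ s.1 s.2) = 0) (ht : y t.1 (φ t.1 t.2) = 0) :
    IsCritical (Pi.single (slotIndex φ) 1) y := by
  classical
  intro Z hZ
  rw [svForm_single, svMonomial_slotIndex, ← Fintype.prod_sigma' (fun i s => Z i (φ i s)),
    ← Finset.mul_prod_erase _ _ (Finset.mem_univ s),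
    ← Finset.mul_prod_erase _ _ (Finset.mem_erase.mpr ⟨hst.symm, Finset.mem_univ t⟩), ← mul_assoc]
  refine mul_eq_zero_of_left ?_ _
  have h1 : (Z s.1 (φ s.1 s.2)).fst = 0 := by rw [hZ, hs]
  have h2 : (Z t.1 (φ t.1 t.2)).fst = 0 := by rw [hZ, ht]
  ext <;> simp [h1, h2]

/-- The symmetric bilinear pattern `M` is the Hessian of a form. -/
theorem exists_chartHessian_eq (j : (i : Fin (r + 1)) → Fin (n i + 1))
    (Q : ((i : Fin (r + 1)) → Fin (n i + 1)) → Prop)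
    (M : Matrix (ChartVar j) (ChartVar j) ℂ) (hM : M.IsSymm)
    (hQ : ∀ v w, M v w ≠ 0 → ∃ φ : (i : Fin (r + 1)) → Fin (d i) → Fin (n i + 1),
      (∀ (R : Type) [CommRing R] [Algebra ℂ R] (u : ChartVar j → R),
        svMonomial (chartPoint j u) (slotIndex φ) = u v * u w) ∧
      ∀ l, Q l → ∃ s t : Σ i, Fin (d i), s ≠ t ∧ φ s.1 s.2 ≠ l s.1 ∧ φ t.1 t.2 ≠ l t.1) :
    ∃ b : SVIndex n d → ℂ, (∀ l, Q l → IsCritical b (chartPoint l 0)) ∧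
      chartHessian (fun _ => 1) j b = M := by
  classical
  have hb : ∀ v w, ∃ b : SVIndex n d → ℂ, (∀ l, Q l → IsCritical b (chartPoint l 0)) ∧
      ∀ (R : Type) [CommRing R] [Algebra ℂ R] (u : ChartVar j → R),
        svForm b (chartPoint j u) = algebraMap ℂ R (M v w) * (u v * u w) := by
    intro v w
    by_cases h0 : M v w = 0
    · exact ⟨0, fun l _ => (criticalForms d _).zero_mem, fun R _ _ u => by simp [h0, svForm_zero]⟩
    · obtain ⟨φ, h1, h2⟩ := hQ v w h0
      refine ⟨M v w • Pi.single (slotIndex φ) 1, fun l hl =>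
        (criticalForms d _).smul_mem _ ?_, fun R _ _ u => ?_⟩
      · obtain ⟨s, t, hst, hs, ht⟩ := h2 l hl
        exact isCritical_single hst (by simp [chartPoint, hs]) (by simp [chartPoint, ht])
      · rw [svForm_smul, svForm_single, h1]
  choose b hb hbf using hb
  -- By symmetry the Hessian of `∑ M v w u_v u_w` is `2 M`.
  refine ⟨(2⁻¹ : ℂ) • ∑ v, ∑ w, b v w, fun l hl => (criticalForms d _).smul_mem _
    ((criticalForms d _).sum_mem fun v _ => (criticalForms d _).sum_mem fun w _ => hb v w l hl), ?_⟩
  ext v w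
  simp only [chartHessian, chartForm, linearSubst_one, svForm_smul, svForm_sum, hbf,
    MvPolynomial.algebraMap_eq, Matrix.of_apply, map_sum, Derivation.leibniz, MvPolynomial.pderiv_C,
    MvPolynomial.pderiv_X, smul_eq_mul, map_add, map_mul, MvPolynomial.eval_C, MvPolynomial.eval_X]
  simp [Pi.single_apply, mul_add, Finset.sum_add_distrib, hM.apply]
  ring

end

/-! ### Forms with nondegenerate critical points at the coordinate points -/

/-- An injection of a set into its complement extends to an involution that fixes all the other
elements. -/
theorem exists_involutive_of_injOn {V : Type} (A : Set V) (f : V → V) (hf : Set.InjOn f A)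
    (hfA : ∀ a ∈ A, f a ∉ A) :
    ∃ τ : V → V, Function.Involutive τ ∧ ∀ v, (v ∈ A ∧ τ v = f v) ∨ (τ v ∈ A ∧ v = f (τ v)) ∨
      (v ∉ A ∧ (∀ a ∈ A, f a ≠ v) ∧ τ v = v) := by
  classical
  let τ : V → V := fun v => if v ∈ A then f v else if h : ∃ a ∈ A, f a = v then h.choose else v
  have h1 : ∀ v ∈ A, τ v = f v := fun v hv => if_pos hv
  have h2 : ∀ a ∈ A, τ (f a) = a := fun a ha => by
    have h : ∃ b ∈ A, f b = f a := ⟨a, ha, rfl⟩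
    simp only [τ, if_neg (hfA a ha), dif_pos h]
    exact hf h.choose_spec.1 ha h.choose_spec.2
  have h3 : ∀ v, v ∉ A → (∀ a ∈ A, f a ≠ v) → τ v = v := fun v hv hv' => by
    have h : ¬ ∃ a ∈ A, f a = v := by
      rintro ⟨a, ha, h⟩
      exact hv' a ha h
    simp only [τ, if_neg hv, dif_neg h]
  have h4 : ∀ v, v ∈ A ∨ (∃ a ∈ A, f a = v) ∨ (v ∉ A ∧ ∀ a ∈ A, f a ≠ v) := fun v => by
    by_cases hv : v ∈ A
    · exact Or.inl hv
    · by_cases h : ∃ a ∈ A, f a = v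
      · exact Or.inr (Or.inl h)
      · push Not at h
        exact Or.inr (Or.inr ⟨hv, h⟩)
  refine ⟨τ, fun v => ?_, fun v => ?_⟩
  · rcases h4 v with hv | ⟨a, ha, rfl⟩ | ⟨hv, hv'⟩
    · rw [h1 v hv, h2 v hv]
    · rw [h2 a ha, h1 a ha]
    · rw [h3 v hv hv', h3 v hv hv']
  · rcases h4 v with hv | ⟨a, ha, rfl⟩ | ⟨hv, hv'⟩
    · exact Or.inl ⟨hv, h1 v hv⟩
    · exact Or.inr (Or.inl ⟨(h2 a ha).symm ▸ ha, by rw [h2 a ha]⟩)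
    · exact Or.inr (Or.inr ⟨hv, hv', h3 v hv hv'⟩)

theorem exists_derangement {T : Type} [Fintype T] (h : 2 ≤ Fintype.card T) :
    ∃ σ : Equiv.Perm T, ∀ x, σ x ≠ x := by
  obtain ⟨m, hm⟩ := Nat.exists_eq_add_of_le' h
  let e : T ≃ Fin (m + 2) := Fintype.equivFinOfCardEq hm
  refine ⟨(e.trans (finRotate (m + 2))).trans e.symm, fun x hx => ?_⟩
  simp [Equiv.symm_apply_eq] at hx

theorem Matrix.det_ne_zero_of_involutive {V : Type} [Fintype V] [DecidableEq V] {τ : V → V}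
    (hτ : Function.Involutive τ) :
    (Matrix.of fun v w => if w = τ v then (1 : ℂ) else 0).det ≠ 0 := by
  intro h
  obtain ⟨u, hu, h0⟩ := Matrix.exists_mulVec_eq_zero_iff.mpr h
  apply hu
  funext v
  have := congrFun h0 (τ v)
  simpa [Matrix.mulVec, dotProduct, hτ v] using this

/-- Every entry of a kernel vector equals the sum `S` of all entries, so `(1 - card V) S = 0`. -/
theorem Matrix.det_ne_zero_of_offDiagonal {V : Type} [Fintype V] [DecidableEq V]
    (hV : Fintype.card V ≠ 1) : (Matrix.of fun v w : V => if w = v then (0 : ℂ) else 1).det ≠ 0 := by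
  intro h
  obtain ⟨u, hu, h0⟩ := Matrix.exists_mulVec_eq_zero_iff.mpr h
  have h1 : ∀ v, u v = ∑ w, u w := fun v => by
    have h2 := congrFun h0 v
    simp only [Matrix.mulVec, dotProduct, Matrix.of_apply, ite_mul, zero_mul, one_mul,
      Pi.zero_apply] at h2
    have h3 : ∑ w, u w = u v + ∑ w, if w = v then 0 else u w := by
      rw [← Finset.add_sum_erase _ _ (Finset.mem_univ v),
        ← Finset.add_sum_erase Finset.univ (fun w => if w = v then 0 else u w) (Finset.mem_univ v)]
      rw [if_pos rfl, zero_add]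
      congr 1
      exact Finset.sum_congr rfl fun w hw => by rw [if_neg (Finset.ne_of_mem_erase hw)]
    rw [h3, h2, add_zero]
  have h2 : ∑ w, u w = Fintype.card V * ∑ w, u w := by
    conv_lhs => rw [Finset.sum_congr rfl fun v _ => h1 v]
    simp
  have h3 : (1 - (Fintype.card V : ℂ)) * ∑ w, u w = 0 := by linear_combination h2
  rcases mul_eq_zero.mp h3 with h4 | h4
  · apply hV
    have : ((1 : ℕ) : ℂ) = Fintype.card V := by push_cast; linear_combination h4
    exact_mod_cast this.symm
  · exact hu (funext fun v => (h1 v).trans h4)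

section

variable {r : ℕ} {n d : Fin (r + 1) → ℕ}

/-- The product of the coordinates `v` and `w` of a chart at a coordinate point occurs in the forms
that are critical at all the coordinate points. -/
def IsAdmissiblePair (n d : Fin (r + 1) → ℕ) {j : (i : Fin (r + 1)) → Fin (n i + 1)}
    (v w : ChartVar j) : Prop :=
  (v.1.1 ≠ w.1.1 ∨ 2 ≤ d v.1.1) ∧
    (4 ≤ ∑ i, d i ∨ v.1.2.val ≠ w.1.2.val ∨ n 0 < v.1.2.val)

theorem IsAdmissiblePair.symm {j : (i : Fin (r + 1)) → Fin (n i + 1)} {v w : ChartVar j}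
    (h : IsAdmissiblePair n d v w) : IsAdmissiblePair n d w v := by
  obtain ⟨h1, h2⟩ := h
  refine ⟨?_, ?_⟩
  · by_cases h : v.1.1 = w.1.1
    · exact Or.inr (h ▸ h1.resolve_left (not_not_intro h))
    · exact Or.inl fun h' => h h'.symm
  · by_cases h : v.1.2.val = w.1.2.val
    · rw [← h]
      rcases h2 with h2 | h2 | h2
      · exact Or.inl h2
      · exact absurd h h2
      · exact Or.inr (Or.inr h2)
    · exact Or.inr (Or.inl fun h' => h h'.symm)

/-- Two slots receive the variables `v` and `w`, all the others the index `k`. At the point `k`,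
these two slots vanish. At a point `m ≠ k`, all remaining slots vanish: there are two of them in
degree at least four, but only one in degree three. In that case `v` or `w` must vanish as well,
which fails only if both have index `m`; different indices, or an index above `n 0`, exclude this.
-/
theorem IsAdmissiblePair.exists_slots (hd : ∀ i, 0 < d i) (hn : ∀ i, n 0 ≤ n i)
    (hD : 3 ≤ ∑ i, d i) {k : Fin (n 0 + 1)} {v w : ChartVar (diagIndex hn k)}
    (h : IsAdmissiblePair n d v w) :
    ∃ φ : (i : Fin (r + 1)) → Fin (d i) → Fin (n i + 1),
      (∀ (R : Type) [CommRing R] [Algebra ℂ R] (u : ChartVar (diagIndex hn k) → R),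
        svMonomial (chartPoint (diagIndex hn k) u) (slotIndex φ) = u v * u w) ∧
      ∀ l, (∃ m, l = diagIndex hn m) →
        ∃ s t : Σ i, Fin (d i), s ≠ t ∧ φ s.1 s.2 ≠ l s.1 ∧ φ t.1 t.2 ≠ l t.1 := by
  classical
  obtain ⟨⟨i, a⟩, hv⟩ := v
  obtain ⟨⟨i', a'⟩, hw⟩ := w
  obtain ⟨h1, h2⟩ := h
  simp only at hv hw h1 h2
  -- Two variables of the same factor need two slots there, which is the first half of
  -- admissibility.
  obtain ⟨s, t, hst⟩ : ∃ (s : Fin (d i)) (t : Fin (d i')),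
      (⟨i, s⟩ : Σ i, Fin (d i)) ≠ ⟨i', t⟩ := by
    by_cases hi : i = i'
    · subst hi
      have h3 := h1.resolve_left (not_not_intro rfl)
      exact ⟨⟨0, by lia⟩, ⟨1, by lia⟩, by simp⟩
    · exact ⟨⟨0, hd i⟩, ⟨0, hd i'⟩, fun h => hi (congrArg Sigma.fst h)⟩
  let ψ : (p : Σ i, Fin (d i)) → Fin (n p.1 + 1) := Function.update
    (Function.update (fun p => diagIndex hn k p.1) ⟨i, s⟩ a) ⟨i', t⟩ a'
  have hψt : ψ ⟨i', t⟩ = a' := Function.update_self ..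
  have hψs : ψ ⟨i, s⟩ = a := by
    simp only [ψ]
    rw [Function.update_of_ne hst, Function.update_self]
  have hψ : ∀ p, p ≠ ⟨i, s⟩ → p ≠ ⟨i', t⟩ → ψ p = diagIndex hn k p.1 := fun p hp hp' => by
    simp only [ψ]
    rw [Function.update_of_ne hp', Function.update_of_ne hp]
  have hdiag : ∀ m i, diagIndex hn k i = diagIndex hn m i → k = m := fun m i h =>
    Fin.castLE_injective _ h
  have hcard : (Finset.univ : Finset (Σ i, Fin (d i))).card = ∑ i, d i := by simp
  refine ⟨fun i s => ψ ⟨i, s⟩, fun R _ _ u => ?_, ?_⟩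
  · rw [svMonomial_slotIndex, ← Fintype.prod_sigma' (fun i s => chartPoint _ u i (ψ ⟨i, s⟩)),
      ← Finset.mul_prod_erase _ _ (Finset.mem_univ (⟨i, s⟩ : Σ i, Fin (d i))),
      ← Finset.mul_prod_erase _ _ (Finset.mem_erase.mpr
        ⟨hst.symm, Finset.mem_univ (⟨i', t⟩ : Σ i, Fin (d i))⟩), Finset.prod_eq_one, mul_one]
    · simp only [hψs, hψt]
      simp [chartPoint, hv, hw]
    · intro p hp
      simp only [Finset.mem_erase, Finset.mem_univ, and_true] at hp
      rw [hψ p hp.2 hp.1]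
      simp [chartPoint]
  · rintro _ ⟨m, rfl⟩
    change ∃ p q : Σ i, Fin (d i), p ≠ q ∧ ψ p ≠ diagIndex hn m p.1 ∧ ψ q ≠ diagIndex hn m q.1
    by_cases hkm : k = m
    · subst hkm
      exact ⟨⟨i, s⟩, ⟨i', t⟩, hst, by rwa [hψs], by rwa [hψt]⟩
    · obtain ⟨p, hp⟩ : ((Finset.univ.erase (⟨i, s⟩ : Σ i, Fin (d i))).erase ⟨i', t⟩).Nonempty := by
        rw [← Finset.card_pos, Finset.card_erase_of_mem (by simp [hst.symm]),
          Finset.card_erase_of_mem (by simp), hcard]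
        lia
      have hp' := hp
      simp only [Finset.mem_erase, Finset.mem_univ, and_true] at hp
      have hpm : ψ p ≠ diagIndex hn m p.1 := by
        rw [hψ _ hp.2 hp.1]
        exact fun h => hkm (hdiag m _ h)
      by_cases ha : a = diagIndex hn m i
      · by_cases ha' : a' = diagIndex hn m i'
        · have h3 : 4 ≤ ∑ i, d i := by
            rcases h2 with h2 | h2 | h2
            · exact h2
            · exact absurd (by rw [ha, ha']; rfl) h2
            · have := m.2
              have h4 : a.val = m.val := by rw [ha]; rfl
              lia
          obtain ⟨q, hq⟩ : (((Finset.univ.erase (⟨i, s⟩ : Σ i, Fin (d i))).erase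
              ⟨i', t⟩).erase p).Nonempty := by
            rw [← Finset.card_pos, Finset.card_erase_of_mem hp',
              Finset.card_erase_of_mem (by simp [hst.symm]),
              Finset.card_erase_of_mem (by simp), hcard]
            lia
          simp only [Finset.mem_erase, Finset.mem_univ, and_true] at hq
          refine ⟨p, q, hq.1.symm, hpm, ?_⟩
          rw [hψ _ hq.2.2 hq.2.1]
          exact fun h => hkm (hdiag m _ h)
        · exact ⟨p, ⟨i', t⟩, hp.1, hpm, by rwa [hψt]⟩
      · exact ⟨p, ⟨i, s⟩, hp.2, hpm, by rwa [hψs]⟩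

/-- A nondegenerate symmetric matrix supported on admissible pairs is the Hessian of a form that is
critical at all the coordinate points. -/
theorem exists_chartHessian_det_ne_zero (hd : ∀ i, 0 < d i) (hn : ∀ i, n 0 ≤ n i)
    (hD : 3 ≤ ∑ i, d i) (k : Fin (n 0 + 1))
    (M : Matrix (ChartVar (diagIndex hn k)) (ChartVar (diagIndex hn k)) ℂ) (hM : M.IsSymm)
    (hdet : M.det ≠ 0) (hadm : ∀ v w, M v w ≠ 0 → IsAdmissiblePair n d v w) :
    ∃ b : SVIndex n d → ℂ, (∀ l, IsCritical b (chartPoint (diagIndex hn l) 0)) ∧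
      (chartHessian (fun _ => 1) (diagIndex hn k) b).det ≠ 0 := by
  obtain ⟨b, hb, hbM⟩ := exists_chartHessian_eq (d := d) (diagIndex hn k)
    (fun l => ∃ m, l = diagIndex hn m) M hM fun v w h => (hadm v w h).exists_slots hd hn hD
  exact ⟨b, fun l => hb _ ⟨l, rfl⟩, hbM ▸ hdet⟩

/-- The Hessian is the permutation matrix of the involution that exchanges `a ∈ A` with `f a`; its
fixed points contribute squares of the unmatched variables. -/
theorem exists_chartHessian_det_ne_zero_of_injOn (hd : ∀ i, 0 < d i) (hn : ∀ i, n 0 ≤ n i)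
    (hD : 3 ≤ ∑ i, d i) (k : Fin (n 0 + 1)) (A : Set (ChartVar (diagIndex hn k)))
    (f : ChartVar (diagIndex hn k) → ChartVar (diagIndex hn k)) (hf : Set.InjOn f A)
    (hfA : ∀ a ∈ A, f a ∉ A) (h1 : ∀ a ∈ A, IsAdmissiblePair n d a (f a))
    (h2 : ∀ v, v ∉ A → (∀ a ∈ A, f a ≠ v) → IsAdmissiblePair n d v v) :
    ∃ b : SVIndex n d → ℂ, (∀ l, IsCritical b (chartPoint (diagIndex hn l) 0)) ∧
      (chartHessian (fun _ => 1) (diagIndex hn k) b).det ≠ 0 := by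
  obtain ⟨τ, hτ, h⟩ := exists_involutive_of_injOn A f hf hfA
  refine exists_chartHessian_det_ne_zero hd hn hD k
    (Matrix.of fun v w => if w = τ v then (1 : ℂ) else 0) ?_ (Matrix.det_ne_zero_of_involutive hτ) ?_
  · ext v w
    simp only [Matrix.transpose_apply, Matrix.of_apply]
    congr 1
    exact propext ⟨fun h => by rw [h, hτ], fun h => by rw [h, hτ]⟩
  · intro v w hvw
    simp only [Matrix.of_apply, ne_eq, ite_eq_right_iff, one_ne_zero, imp_false, not_not] at hvw
    subst hvw
    rcases h v with ⟨hv, h⟩ | ⟨hv, h⟩ | ⟨hv, hv', h⟩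
    · rw [h]
      exact h1 v hv
    · have := (h1 _ hv).symm
      rwa [← h] at this
    · rw [h]
      exact h2 v hv hv'

end

/-! ### Nondegenerate matchings, case by case -/

section

variable {r : ℕ} {n d : Fin (r + 1) → ℕ}

theorem ChartVar.ext_val {j : (i : Fin (r + 1)) → Fin (n i + 1)} {v w : ChartVar j}
    (h1 : v.1.1 = w.1.1) (h2 : v.1.2.val = w.1.2.val) : v = w := by
  obtain ⟨⟨i, a⟩, hv⟩ := v
  obtain ⟨⟨i', a'⟩, hw⟩ := w
  simp only at h1 h2
  subst h1
  obtain rfl := Fin.ext h2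
  rfl

theorem ChartVar.card_filter_fst (j : (i : Fin (r + 1)) → Fin (n i + 1)) (i : Fin (r + 1)) :
    (Finset.univ.filter fun v : ChartVar j => v.1.1 = i).card = n i := by
  classical
  have h : (Finset.univ.filter fun v : ChartVar j => v.1.1 = i) =
      Finset.univ.image fun k : {k : Fin (n i + 1) // k ≠ j i} => (⟨⟨i, k.1⟩, k.2⟩ : ChartVar j) := by
    ext v
    simp only [Finset.mem_filter, Finset.mem_univ, true_and, Finset.mem_image]
    constructor
    · rintro rfl
      exact ⟨⟨v.1.2, v.2⟩, rfl⟩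
    · rintro ⟨k, rfl⟩
      rfl
  rw [h, Finset.card_image_of_injective]
  · simp
  · rintro ⟨k, hk⟩ ⟨l, hl⟩ hkl
    simpa using hkl

/-- The coordinate of a chart at a diagonal coordinate point with given factor and index. -/
def ChartVar.mk {hn : ∀ i, n 0 ≤ n i} {k : Fin (n 0 + 1)} (i : Fin (r + 1)) (a : ℕ)
    (ha : a < n i + 1) (hak : a ≠ k.val) : ChartVar (diagIndex hn k) :=
  ⟨⟨i, ⟨a, ha⟩⟩, fun h => hak (congrArg Fin.val h)⟩

theorem ChartVar.val_ne {hn : ∀ i, n 0 ≤ n i} {k : Fin (n 0 + 1)} (v : ChartVar (diagIndex hn k)) :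
    v.1.2.val ≠ k.val := fun h => v.2 (Fin.ext h)

/-- In degree at least four only the slots restrict the pairs. Variables outside the last factor
inject into those of the last one by `hlast`, and the leftover variables have admissible squares as
`2 ≤ d (Fin.last r)`. -/
theorem exists_chartHessian_of_four_le (hd : ∀ i, 0 < d i) (hn : ∀ i, n 0 ≤ n i)
    (hD : 4 ≤ ∑ i, d i) (hlast : ∑ i : Fin r, n i.castSucc < n (Fin.last r))
    (hdlast : 2 ≤ d (Fin.last r)) (k : Fin (n 0 + 1)) :
    ∃ b : SVIndex n d → ℂ, (∀ l, IsCritical b (chartPoint (diagIndex hn l) 0)) ∧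
      (chartHessian (fun _ => 1) (diagIndex hn k) b).det ≠ 0 := by
  classical
  let V := ChartVar (diagIndex hn k)
  have hcard : Fintype.card {v : V // v.1.1 ≠ Fin.last r} ≤
      Fintype.card {v : V // v.1.1 = Fin.last r} := by
    rw [Fintype.card_subtype, Fintype.card_subtype, ChartVar.card_filter_fst]
    have hsub : (Finset.univ.filter fun v : V => v.1.1 ≠ Fin.last r) ⊆
        Finset.univ.biUnion fun i : Fin r => Finset.univ.filter fun v : V => v.1.1 = i.castSucc := by
      intro v hv
      simp only [Finset.mem_filter, Finset.mem_univ, true_and] at hv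
      simp only [Finset.mem_biUnion, Finset.mem_filter, Finset.mem_univ, true_and]
      exact ⟨v.1.1.castPred hv, (Fin.castSucc_castPred _ _).symm⟩
    refine (Finset.card_le_card hsub).trans (Finset.card_biUnion_le.trans ?_)
    simp only [V, ChartVar.card_filter_fst]
    exact hlast.le
  obtain ⟨e⟩ := Function.Embedding.nonempty_of_card_le hcard
  let f : V → V := fun v => if h : v.1.1 ≠ Fin.last r then (e ⟨v, h⟩).1 else v
  have hf : ∀ v : V, ∀ h : v.1.1 ≠ Fin.last r, f v = (e ⟨v, h⟩).1 := fun v h => dif_pos h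
  have hf' : ∀ v : V, v.1.1 ≠ Fin.last r → (f v).1.1 = Fin.last r := fun v h => by
    rw [hf v h]
    exact (e ⟨v, h⟩).2
  refine exists_chartHessian_det_ne_zero_of_injOn hd hn (by lia) k
    {v : V | v.1.1 ≠ Fin.last r} f ?_ ?_ ?_ ?_
  · intro v hv w hw h
    rw [hf v hv, hf w hw] at h
    simpa using e.injective (Subtype.ext h)
  · intro v hv h
    exact h (hf' v hv)
  · intro v hv
    exact ⟨Or.inl fun h => hv (h.trans (hf' v hv)), Or.inl hD⟩
  · intro v hv _
    have hv' : v.1.1 = Fin.last r := not_not.mp hv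
    exact ⟨Or.inr (hv' ▸ hdlast), Or.inl hD⟩

end

/-- Squares need not be admissible when the degree is three, but all products of distinct variables
are: the off-diagonal matrix of size `n 0 ≠ 1` works. -/
theorem exists_chartHessian_veronese {n d : Fin 1 → ℕ} (hd : 3 ≤ d 0) (hn : ∀ i, n 0 ≤ n i)
    (hn0 : 2 ≤ n 0) (k : Fin (n 0 + 1)) :
    ∃ b : SVIndex n d → ℂ, (∀ l, IsCritical b (chartPoint (diagIndex hn l) 0)) ∧
      (chartHessian (fun _ => 1) (diagIndex hn k) b).det ≠ 0 := by
  have hi : ∀ i : Fin 1, i = 0 := fun i => Subsingleton.elim _ _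
  refine exists_chartHessian_det_ne_zero (fun i => by rw [hi i]; lia) hn (by simpa using hd) k
    (Matrix.of fun v w => if w = v then (0 : ℂ) else 1) ?_ (Matrix.det_ne_zero_of_offDiagonal ?_) ?_
  · ext v w
    simp [eq_comm]
  · have h := ChartVar.card_filter_fst (diagIndex hn k) 0
    rw [Finset.filter_true_of_mem fun v _ => hi _, Finset.card_univ] at h
    rw [h]
    lia
  · intro v w hvw
    simp only [Matrix.of_apply, ne_eq, ite_eq_left_iff, one_ne_zero, imp_false, not_not] at hvw
    refine ⟨Or.inr ?_, Or.inr (Or.inl fun h => hvw (ChartVar.ext_val ?_ h.symm))⟩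
    · rw [hi v.1.1]
      lia
    · rw [hi v.1.1, hi w.1.1]

/-- In bidegree `(1, 2)` two variables of equal index at most `n 0` may not be paired, so the first
factor is matched with the second through a derangement of the indices other than `k`. The unmatched
variables have index above `n 0`, and their squares are admissible. -/
theorem exists_chartHessian_of_two_le {n d : Fin 2 → ℕ} (hd0 : d 0 = 1) (hd1 : d 1 = 2)
    (hn : ∀ i, n 0 ≤ n i) (hn0 : 2 ≤ n 0) (k : Fin (n 0 + 1)) :
    ∃ b : SVIndex n d → ℂ, (∀ l, IsCritical b (chartPoint (diagIndex hn l) 0)) ∧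
      (chartHessian (fun _ => 1) (diagIndex hn k) b).det ≠ 0 := by
  classical
  obtain ⟨σ, hσ⟩ := exists_derangement (T := {a : Fin (n 0 + 1) // a ≠ k}) (by simpa using hn0)
  let V := ChartVar (diagIndex hn k)
  let c : (v : V) → v.1.2.val < n 0 + 1 → {a : Fin (n 0 + 1) // a ≠ k} := fun v h =>
    ⟨⟨v.1.2.val, h⟩, fun h' => v.val_ne (congrArg Fin.val h')⟩
  let f : V → V := fun v => if h : v.1.2.val < n 0 + 1 then
    ChartVar.mk 1 (σ (c v h)).1.val ((σ (c v h)).1.2.trans_le (Nat.succ_le_succ (hn 1)))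
      (fun h' => (σ (c v h)).2 (Fin.ext h')) else v
  have h0 : ∀ v : V, v.1.1 = 0 → v.1.2.val < n 0 + 1 := fun v hv => hv ▸ v.1.2.2
  have hf : ∀ v : V, ∀ h : v.1.2.val < n 0 + 1,
      (f v).1.1 = 1 ∧ (f v).1.2.val = (σ (c v h)).1.val := fun v h => by
    have hfv : f v = ChartVar.mk 1 (σ (c v h)).1.val
        ((σ (c v h)).1.2.trans_le (Nat.succ_le_succ (hn 1)))
        (fun h' => (σ (c v h)).2 (Fin.ext h')) := dif_pos h
    rw [hfv]
    exact ⟨rfl, rfl⟩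
  refine exists_chartHessian_det_ne_zero_of_injOn (fun i => by fin_cases i <;> simp [hd0, hd1]) hn
    (by simp [Fin.sum_univ_two, hd0, hd1]) k {v : V | v.1.1 = 0} f ?_ ?_ ?_ ?_
  · intro v hv w hw h
    have h1 := (hf v (h0 v hv)).2
    rw [h, (hf w (h0 w hw)).2] at h1
    have h2 := σ.injective (Subtype.ext (Fin.ext h1))
    exact ChartVar.ext_val (hv.trans hw.symm) (congrArg (fun a => a.1.val) h2).symm
  · intro v hv h
    rw [Set.mem_ofPred_eq, (hf v (h0 v hv)).1] at h
    exact absurd h (by decide)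
  · intro v hv
    have h1 := hf v (h0 v hv)
    refine ⟨Or.inl ?_, Or.inr (Or.inl fun h => hσ (c v (h0 v hv)) ?_)⟩
    · rw [h1.1, show v.1.1 = 0 from hv]
      decide
    · rw [h1.2] at h
      exact Subtype.ext (Fin.ext h.symm)
  · intro v hv himg
    have hv1 : v.1.1 = 1 := by
      have : v.1.1 ≠ 0 := hv
      lia
    refine ⟨Or.inr (by rw [hv1, hd1]), Or.inr (Or.inr ?_)⟩
    by_contra hlt
    have hlt' : v.1.2.val < n 0 + 1 := by lia
    -- An index at most `n 0` in the second factor is hit by the matching, so `v` would not be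
    -- unmatched.
    let a := σ.symm (c v hlt')
    refine himg (ChartVar.mk 0 a.1.val a.1.2 fun h' => a.2 (Fin.ext h')) rfl ?_
    refine ChartVar.ext_val ?_ ?_
    · rw [(hf _ a.1.2).1, hv1]
    · rw [(hf _ a.1.2).2]
      have : c (ChartVar.mk 0 a.1.val a.1.2 fun h' => a.2 (Fin.ext h')) a.1.2 = a := rfl
      rw [this, σ.apply_symm_apply]

/-- With `n 0 = 1` no derangement exists: each factor has a single chart variable of index at most
`1`, with the same index in both. These two are matched with the variables of index `2` and `3` in
the second factor, which exist because `3 ≤ n 1`; the remaining indices exceed `n 0`, so squares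
serve. -/
theorem exists_chartHessian_of_eq_one {n d : Fin 2 → ℕ} (hd0 : d 0 = 1) (hd1 : d 1 = 2)
    (hn : ∀ i, n 0 ≤ n i) (hn0 : n 0 = 1) (hn1 : 3 ≤ n 1) (k : Fin (n 0 + 1)) :
    ∃ b : SVIndex n d → ℂ, (∀ l, IsCritical b (chartPoint (diagIndex hn l) 0)) ∧
      (chartHessian (fun _ => 1) (diagIndex hn k) b).det ≠ 0 := by
  have hk := k.2
  let V := ChartVar (diagIndex hn k)
  let f : V → V := fun v => if v.1.1 = 0 then ChartVar.mk 1 2 (by lia) (by lia)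
    else ChartVar.mk 1 3 (by lia) (by lia)
  have hf1 : ∀ v, (f v).1.1 = 1 := fun v => by
    simp only [f]
    split_ifs <;> rfl
  have hf2 : ∀ v, (f v).1.2.val = if v.1.1 = 0 then 2 else 3 := fun v => by
    by_cases h : v.1.1 = 0
    · have hfv : f v = ChartVar.mk 1 2 (by lia) (by lia) := if_pos h
      rw [hfv, if_pos h]
      rfl
    · have hfv : f v = ChartVar.mk 1 3 (by lia) (by lia) := if_neg h
      rw [hfv, if_neg h]
      rfl
  refine exists_chartHessian_det_ne_zero_of_injOn (fun i => by fin_cases i <;> simp [hd0, hd1]) hn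
    (by simp [Fin.sum_univ_two, hd0, hd1]) k {v : V | v.1.2.val ≤ 1} f ?_ ?_ ?_ ?_
  · intro v hv w hw h
    have h1 := hf2 v
    rw [h, hf2 w] at h1
    have h3 := v.val_ne
    have h4 := w.val_ne
    have hv' : v.1.2.val ≤ 1 := hv
    have hw' : w.1.2.val ≤ 1 := hw
    refine ChartVar.ext_val ?_ (by lia)
    split_ifs at h1 <;> lia
  · intro v hv h
    rw [Set.mem_ofPred_eq, hf2] at h
    split_ifs at h <;> lia
  · intro v hv
    have hv' : v.1.2.val ≤ 1 := hv
    refine ⟨?_, Or.inr (Or.inl ?_)⟩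
    · rw [hf1]
      by_cases h : v.1.1 = 0
      · rw [h]
        exact Or.inl (by decide)
      · have : v.1.1 = 1 := by lia
        rw [this, hd1]
        exact Or.inr le_rfl
    · rw [hf2]
      split_ifs <;> lia
  · intro v hv _
    have hv' : ¬ v.1.2.val ≤ 1 := hv
    have h1 : v.1.1 = 1 := by
      by_contra h
      have h0 : v.1.1 = 0 := by lia
      have := v.1.2.2
      have hn' : n v.1.1 = n 0 := congrArg n h0
      lia
    exact ⟨Or.inr (by rw [h1, hd1]), Or.inr (Or.inr (by lia))⟩

/-! ### Binary cubic forms -/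

theorem exists_prod_eq_cubic {e : ℕ} (he : e = 3) (y w : Fin e → ℂ) :
    ∃ c : Fin 4 → ℂ, ∀ (R : Type) [CommRing R] [Algebra ℂ R] (s t : R),
      ∏ i, (s * algebraMap ℂ R (y i) + t * algebraMap ℂ R (w i)) =
        algebraMap ℂ R (c 0) * s ^ 3 + algebraMap ℂ R (c 1) * s ^ 2 * t +
          algebraMap ℂ R (c 2) * s * t ^ 2 + algebraMap ℂ R (c 3) * t ^ 3 := by
  subst he
  refine ⟨![y 0 * y 1 * y 2, y 0 * y 1 * w 2 + y 0 * w 1 * y 2 + w 0 * y 1 * y 2,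
    y 0 * w 1 * w 2 + w 0 * y 1 * w 2 + w 0 * w 1 * y 2, w 0 * w 1 * w 2], fun R _ _ s t => ?_⟩
  simp [Fin.prod_univ_three]
  ring

/-- The coefficients do not depend on the algebra: dual numbers detect their vanishing, and complex
values then give the form. -/
theorem exists_svForm_eq_cubic {n d : Fin 1 → ℕ} (hd : d 0 = 3) (a : SVIndex n d → ℂ)
    (y w : (i : Fin 1) → Fin (n i + 1) → ℂ) :
    ∃ c : Fin 4 → ℂ, ∀ (R : Type) [CommRing R] [Algebra ℂ R] (s t : R),
      svForm a (fun i k => s * algebraMap ℂ R (y i k) + t * algebraMap ℂ R (w i k)) =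
        algebraMap ℂ R (c 0) * s ^ 3 + algebraMap ℂ R (c 1) * s ^ 2 * t +
          algebraMap ℂ R (c 2) * s * t ^ 2 + algebraMap ℂ R (c 3) * t ^ 3 := by
  have h : ∀ J : SVIndex n d, ∃ c : Fin 4 → ℂ, ∀ (R : Type) [CommRing R] [Algebra ℂ R] (s t : R),
      svMonomial (fun i k => s * algebraMap ℂ R (y i k) + t * algebraMap ℂ R (w i k)) J =
        algebraMap ℂ R (c 0) * s ^ 3 + algebraMap ℂ R (c 1) * s ^ 2 * t +
          algebraMap ℂ R (c 2) * s * t ^ 2 + algebraMap ℂ R (c 3) * t ^ 3 := by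
    intro J
    obtain ⟨φ, rfl⟩ := slotIndex_surjective J
    obtain ⟨c, hc⟩ := exists_prod_eq_cubic hd (fun s => y 0 (φ 0 s)) (fun s => w 0 (φ 0 s))
    refine ⟨c, fun R _ _ s t => ?_⟩
    rw [svMonomial_slotIndex, Fin.prod_univ_one]
    exact hc R s t
  choose c hc using h
  refine ⟨fun m => ∑ J, a J * c J m, fun R _ _ s t => ?_⟩
  simp only [svForm, hc, map_sum, map_mul, Finset.sum_mul, ← Finset.sum_add_distrib]
  exact Finset.sum_congr rfl fun J _ => by ring

/-- A binary cubic form with two double points is zero. -/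
theorem eq_zero_of_isCritical_binaryCubic {n d : Fin 1 → ℕ} (hd : d 0 = 3) (hn : ∀ i, n 0 ≤ n i)
    (hn0 : n 0 = 1) (a : SVIndex n d → ℂ)
    (ha : ∀ l, IsCritical a (chartPoint (diagIndex hn l) 0)) : a = 0 := by
  have hk : ∀ k : Fin (n 0 + 1), k = 0 ∨ k = Fin.last (n 0) := fun k => by
    have := k.2
    rcases Nat.lt_or_ge k.val 1 with h | h
    · exact Or.inl (Fin.ext (by simpa using h))
    · exact Or.inr (Fin.ext (by rw [Fin.val_last]; lia))
  let e : Fin (n 0 + 1) → (i : Fin 1) → Fin (n i + 1) → ℂ := fun l => chartPoint (diagIndex hn l) 0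
  obtain ⟨c, hc⟩ := exists_svForm_eq_cubic hd a (e 0) (e (Fin.last _))
  -- At `e 0 + ε e 1` the cubic is `c 0 + c 1 ε`, and at `ε e 0 + e 1` it is `c 3 + c 2 ε`, with `e
  -- 1` the last basis vector; both vanish.
  have h1 := ha 0 (fun i k => 1 * algebraMap ℂ (DualNumber ℂ) (e 0 i k) +
    DualNumber.eps * algebraMap ℂ (DualNumber ℂ) (e (Fin.last _) i k))
    (fun i k => by simp [TrivSqZeroExt.algebraMap_eq_inl, e])
  have h2 := ha (Fin.last _) (fun i k => DualNumber.eps * algebraMap ℂ (DualNumber ℂ) (e 0 i k) +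
    1 * algebraMap ℂ (DualNumber ℂ) (e (Fin.last _) i k))
    (fun i k => by simp [TrivSqZeroExt.algebraMap_eq_inl, e])
  rw [hc] at h1 h2
  have hc0 := congrArg TrivSqZeroExt.fst h1
  have hc1 := congrArg TrivSqZeroExt.snd h1
  have hc2 := congrArg TrivSqZeroExt.snd h2
  have hc3 := congrArg TrivSqZeroExt.fst h2
  simp [TrivSqZeroExt.algebraMap_eq_inl, pow_succ] at hc0 hc1 hc2 hc3
  refine eq_zero_of_svForm_eq_zero a fun z => ?_
  have h3 := hc ℂ (z 0 0) (z 0 (Fin.last _))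
  simp only [Algebra.algebraMap_self, RingHom.id_apply, hc0, hc1, hc2, hc3] at h3
  have h4 : z = fun i k => z 0 0 * e 0 i k + z 0 (Fin.last _) * e (Fin.last _) i k := by
    funext i k
    obtain rfl : i = 0 := Subsingleton.elim _ _
    have hne : (0 : Fin (n 0 + 1)) ≠ Fin.last (n 0) := fun h => by
      have := congrArg Fin.val h
      simp [hn0] at this
    rcases hk k with rfl | rfl
    · simp [e, chartPoint, diagIndex, hne]
    · simp [e, chartPoint, diagIndex, hne.symm]
  rw [h4, h3]
  ring

/-! ### The case of degree at least two in the last factor -/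

/-- Since the last degree is at least two, three or more factors force total degree at least four.
Degree three thus leaves cubic Veronese varieties and bidegree `(1, 2)`. -/
theorem not_isWeaklyDefective_segreVeronese (r : ℕ) (n d : Fin (r + 1) → ℕ)
    (hn_pos : ∀ i, 0 < n i) (hd_pos : ∀ i, 0 < d i) (hn_mono : Monotone n)
    (hd_sum : 3 ≤ ∑ i, d i) (hn_last : ∑ i : Fin r, n i.castSucc < n (Fin.last r))
    (hd_last : 2 ≤ d (Fin.last r))
    (hexc : ¬ (r = 1 ∧ n 0 = 1 ∧ n (Fin.last r) = 2 ∧ d 0 = 1 ∧ d (Fin.last r) = 2)) :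
    ¬ IsWeaklyDefective (segreVeronese n d) (n 0 + 1) := by
  have hn : ∀ i, n 0 ≤ n i := fun i => hn_mono (Fin.zero_le i)
  refine not_isWeaklyDefective_of_chartHessian hd_pos hn fun b₀ hb₀ hb₀c k => ?_
  by_cases hD : 4 ≤ ∑ i, d i
  · exact exists_chartHessian_of_four_le hd_pos hn hD hn_last hd_last k
  match r, n, d with
  | 0, n, d =>
    rw [Fin.sum_univ_one] at hD hd_sum
    by_cases h2 : 2 ≤ n 0
    · exact exists_chartHessian_veronese hd_sum hn h2 k
    · have := hn_pos 0
      exact absurd (eq_zero_of_isCritical_binaryCubic (by lia) hn (by lia) b₀ hb₀c) hb₀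
  | 1, n, d =>
    rw [Fin.sum_univ_two] at hD hd_sum
    rw [Fin.sum_univ_one] at hn_last
    change 2 ≤ d 1 at hd_last
    change n 0 < n 1 at hn_last
    have h0 := hd_pos 0
    have hd0 : d 0 = 1 := by lia
    have hd1 : d 1 = 2 := by lia
    by_cases h2 : 2 ≤ n 0
    · exact exists_chartHessian_of_two_le hd0 hd1 hn h2 k
    · have := hn_pos 0
      have hn0 : n 0 = 1 := by lia
      have hn1 : n 1 ≠ 2 := fun h => hexc ⟨rfl, hn0, h, hd0, hd1⟩
      exact exists_chartHessian_of_eq_one hd0 hd1 hn hn0 (by lia) k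
  | r + 2, n, d =>
    exfalso
    rw [Fin.sum_univ_castSucc, Fin.sum_univ_succ, Fin.sum_univ_succ] at hD
    have h1 := hd_pos (Fin.castSucc 0)
    have h2 := hd_pos (Fin.castSucc (Fin.succ 0))
    lia

/-! ### Irreducible subsets -/

/-- Zorn's lemma: the union of a nonempty chain of irreducible sets is irreducible. -/
theorem exists_mem_componentsOf_superset {Y : Type} [TopologicalSpace Y] {S C₀ : Set Y}
    (hC₀ : IsIrreducible C₀) (h : C₀ ⊆ S) : ∃ C ∈ componentsOf S, C₀ ⊆ C := by
  obtain ⟨m, hm, hmax⟩ := zorn_subset_nonempty {D : Set Y | IsIrreducible D ∧ D ⊆ S}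
    (fun c hc hcc hne => by
      refine ⟨⋃₀ c, ⟨⟨?_, ?_⟩, Set.sUnion_subset fun D hD => (hc hD).2⟩,
        fun _ => Set.subset_sUnion_of_mem⟩
      · obtain ⟨D, hD⟩ := hne
        exact (hc hD).1.nonempty.mono (Set.subset_sUnion_of_mem hD)
      · rintro u v hu hv ⟨y, ⟨p, hp, hyp⟩, hyu⟩ ⟨x, ⟨q, hq, hxq⟩, hxv⟩
        rcases hcc.total hp hq with hpq | hqp
        · obtain ⟨z, hz, hzuv⟩ := (hc hq).1.isPreirreducible u v hu hv ⟨y, hpq hyp, hyu⟩ ⟨x, hxq, hxv⟩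
          exact ⟨z, ⟨q, hq, hz⟩, hzuv⟩
        · obtain ⟨z, hz, hzuv⟩ := (hc hp).1.isPreirreducible u v hu hv ⟨y, hyp, hyu⟩ ⟨x, hqp hxq, hxv⟩
          exact ⟨z, ⟨p, hp, hz⟩, hzuv⟩) C₀ ⟨hC₀, h⟩
  exact ⟨m, hmax, hm⟩

/-- A point of `C` and `C` itself form a chain of length one of irreducible closed subsets of `C`.
-/
theorem topologicalKrullDim_pos_of_isIrreducible {Y : Type} [TopologicalSpace Y] [T1Space Y]
    {S C : Set Y} (hC : IsIrreducible C) (hCS : C ⊆ S) (hnt : C.Nontrivial) :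
    0 < topologicalKrullDim S := by
  refine lt_of_lt_of_le ?_ (Topology.IsEmbedding.inclusion hCS).isInducing.topologicalKrullDim_le
  have := Subtype.irreducibleSpace hC
  obtain ⟨x, hx, y, hy, hxy⟩ := hnt
  refine Order.krullDim_pos_iff.mpr ⟨⟨{⟨x, hx⟩}, isIrreducible_singleton, isClosed_singleton⟩,
    ⟨Set.univ, IrreducibleSpace.isIrreducible_univ _, isClosed_univ⟩, ?_⟩
  refine lt_of_le_of_ne (fun _ _ => Set.mem_univ _) fun h => ?_
  have h1 : ({⟨x, hx⟩} : Set C) = Set.univ := congrArg (fun D => D.carrier) h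
  have h2 : (⟨y, hy⟩ : C) ∈ ({⟨x, hx⟩} : Set C) := h1 ▸ Set.mem_univ _
  exact hxy (congrArg Subtype.val (Set.mem_singleton_iff.mp h2)).symm

/-- The points of a linear subspace of projective space. -/
def linearSpacePoints {σ : Type} (L : Submodule ℂ (σ → ℂ)) : Set (PSpace σ) := {x | x.coord ∈ L}

theorem mem_linearSpacePoints_of_isCoord {σ : Type} {L : Submodule ℂ (σ → ℂ)} {x : PSpace σ}
    {v : σ → ℂ} (hx : IsCoord x v) (hv : v ∈ L) : x ∈ linearSpacePoints L := by
  obtain ⟨c, -, hx⟩ := hx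
  change x.coord ∈ L
  rw [hx]
  exact L.smul_mem c hv

/-- On the line joining a point in `U` to a point in `V`, all but finitely many parameters give
points in both open sets. -/
theorem isPreirreducible_linearSpacePoints {σ : Type} [Fintype σ] (L : Submodule ℂ (σ → ℂ)) :
    IsPreirreducible (linearSpacePoints L) := by
  rintro U V hU hV ⟨x, hx, hxU⟩ ⟨y, hy, hyV⟩
  let P : σ → Polynomial ℂ := fun s =>
    Polynomial.C (x.coord s) + Polynomial.X * Polynomial.C ((y.coord - x.coord) s)
  have hP : ∀ t, (fun s => (P s).eval t) = x.coord + t • (y.coord - x.coord) := fun t => by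
    funext s
    simp [P]
  obtain ⟨s, hs⟩ := Function.ne_iff.mp x.coord_ne_zero
  have e1 := PSpace.eventually_mem hU P 0 x hxU (by rw [hP]; simpa using isCoord_coord x)
  have e2 := PSpace.eventually_mem hV P 1 y hyV (by rw [hP]; simpa using isCoord_coord y)
  have e3 : ∀ᶠ t in Filter.cofinite, (P s).eval t ≠ 0 :=
    Polynomial.eventually_cofinite_eval_ne_zero (t₀ := 0) (by simpa [P] using hs)
  obtain ⟨t, ⟨h1, h2⟩, h3⟩ := ((e1.and e2).and e3).exists
  have hne : (fun s => (P s).eval t) ≠ 0 := fun h => h3 (congrFun h s)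
  have hc := isCoord_mk _ hne
  refine ⟨_, mem_linearSpacePoints_of_isCoord hc ?_, h1 _ hc, h2 _ hc⟩
  rw [hP]
  exact L.add_mem hx (L.smul_mem t (L.sub_mem hy hx))

theorem nontrivial_linearSpacePoints {σ : Type} {L : Submodule ℂ (σ → ℂ)}
    (hL : 2 ≤ Module.finrank ℂ L) : (linearSpacePoints L).Nontrivial := by
  have hb : L ≠ ⊥ := by
    rintro rfl
    simp at hL
  obtain ⟨v, hv, hv0⟩ := L.ne_bot_iff.mp hb
  have hx := isCoord_mk v hv0
  refine ⟨_, mem_linearSpacePoints_of_isCoord hx hv, ?_⟩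
  by_contra! h
  have := finrank_le_one (R := ℂ) (⟨v, hv⟩ : L) fun ⟨w, hw⟩ => by
    by_cases hw0 : w = 0
    · exact ⟨0, Subtype.ext (by simp [hw0])⟩
    · have hy := isCoord_mk w hw0
      have hyx := h _ (mem_linearSpacePoints_of_isCoord hy hw)
      rw [hyx] at hx
      obtain ⟨b, hb, hy⟩ := hy
      obtain ⟨c, hc, hx⟩ := hx
      refine ⟨b⁻¹ * c, Subtype.ext ?_⟩
      change (b⁻¹ * c) • v = w
      rw [mul_smul, ← hx, hy, smul_smul, inv_mul_cancel₀ hb, one_smul]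
  lia

theorem exists_submodule_le_finrank_eq {E : Type} [AddCommGroup E] [Module ℂ E]
    [FiniteDimensional ℂ E] (L : Submodule ℂ E) {m : ℕ} (hm : m ≤ Module.finrank ℂ L) :
    ∃ L' ≤ L, Module.finrank ℂ L' = m := by
  let b := Module.finBasis ℂ L
  have hli : LinearIndependent ℂ fun i : Fin m => (b (i.castLE hm) : E) :=
    ((b.linearIndependent.comp _ (Fin.castLE_injective hm)).map' L.subtype L.ker_subtype)
  refine ⟨Submodule.span ℂ (Set.range fun i : Fin m => (b (i.castLE hm) : E)), ?_, ?_⟩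
  · rw [Submodule.span_le]
    rintro _ ⟨i, rfl⟩
    exact (b (i.castLE hm)).2
  · rw [finrank_span_eq_card hli, Fintype.card_fin]

/-! ### The case of degree one in the last factor -/

section

variable {r : ℕ} {n d : Fin (r + 1) → ℕ}

/-- A form as a polynomial in all the variables. -/
def svPolynomial (a : SVIndex n d → ℂ) : MvPolynomial (Σ i : Fin (r + 1), Fin (n i + 1)) ℂ :=
  svForm a fun i k => MvPolynomial.X ⟨i, k⟩

theorem aeval_svPolynomial {R : Type} [CommRing R] [Algebra ℂ R] (a : SVIndex n d → ℂ)
    (u : (Σ i : Fin (r + 1), Fin (n i + 1)) → R) :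
    MvPolynomial.aeval u (svPolynomial a) = svForm a fun i k => u ⟨i, k⟩ := by
  rw [svPolynomial, map_svForm]
  simp only [MvPolynomial.aeval_X]

/-- The partial derivatives of a form. -/
def svPartial (a : SVIndex n d → ℂ) (p : Σ i : Fin (r + 1), Fin (n i + 1))
    (y : (i : Fin (r + 1)) → Fin (n i + 1) → ℂ) : ℂ :=
  MvPolynomial.eval (fun q => y q.1 q.2) (MvPolynomial.pderiv p (svPolynomial a))

theorem fst_snd_svForm (a : SVIndex n d → ℂ) (Z : (i : Fin (r + 1)) → Fin (n i + 1) → DualNumber ℂ)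
    {y : (i : Fin (r + 1)) → Fin (n i + 1) → ℂ} (hZ : ∀ i k, (Z i k).fst = y i k) :
    (svForm a Z).fst = svForm a y ∧
      (svForm a Z).snd = ∑ p, svPartial a p y * (Z p.1 p.2).snd := by
  have h1 := fst_snd_aeval (fun p : Σ i : Fin (r + 1), Fin (n i + 1) => Z p.1 p.2) (svPolynomial a)
  simp only [aeval_svPolynomial, hZ] at h1
  exact ⟨h1.1.trans (aeval_svPolynomial a fun p => y p.1 p.2), h1.2⟩

theorem isCritical_iff_svPartial (a : SVIndex n d → ℂ) (y : (i : Fin (r + 1)) → Fin (n i + 1) → ℂ) :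
    IsCritical a y ↔ svForm a y = 0 ∧ ∀ p, svPartial a p y = 0 := by
  classical
  constructor
  · refine fun h => ⟨h.svForm_eq_zero, fun p => ?_⟩
    have hZ : ∀ i k, (dualPoint (fun q : Σ i : Fin (r + 1), Fin (n i + 1) => y q.1 q.2)
      (Pi.single p 1) ⟨i, k⟩).fst = y i k := fun i k => by simp [dualPoint]
    have h1 := (fst_snd_svForm a _ hZ).2
    rw [h _ hZ, TrivSqZeroExt.snd_zero, Finset.sum_eq_single p] at h1
    · simpa [dualPoint] using h1.symm
    · intro q _ hq
      simp [dualPoint, hq]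
    · simp
  · rintro ⟨h0, h1⟩ Z hZ
    obtain ⟨h2, h3⟩ := fst_snd_svForm a Z hZ
    ext
    · exact h2.trans h0
    · rw [h3]
      simp [h1]

/-- Euler's relation in one group of variables. -/
theorem sum_svPartial_mul (a : SVIndex n d → ℂ) (y : (i : Fin (r + 1)) → Fin (n i + 1) → ℂ)
    (i : Fin (r + 1)) : ∑ k, svPartial a ⟨i, k⟩ y * y i k = d i * svForm a y := by
  classical
  -- Scaling group `i` by `1 + ε` multiplies the form by `(1 + ε) ^ d i = 1 + d i ε`; the relation
  -- compares `ε`-coefficients.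
  let c : Fin (r + 1) → DualNumber ℂ := fun i' => if i' = i then 1 + DualNumber.eps else 1
  have hZ : ∀ i k, (c i * (TrivSqZeroExt.inl (y i k) : DualNumber ℂ)).fst = y i k := fun i' k => by
    simp only [c]
    split_ifs <;> simp
  have h1 := (fst_snd_svForm a (fun i k => c i * TrivSqZeroExt.inl (y i k)) hZ).2
  have h2 := fst_snd_svForm a (fun i k => (TrivSqZeroExt.inl (y i k) : DualNumber ℂ)) fun i k => rfl
  simp only [TrivSqZeroExt.snd_inl, mul_zero, Finset.sum_const_zero] at h2
  have h3 : ∏ i', c i' ^ d i' = 1 + (d i : DualNumber ℂ) * DualNumber.eps := by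
    rw [Finset.prod_eq_single i]
    · simp only [c, if_pos rfl]
      generalize d i = e
      induction e with
      | zero => simp
      | succ e ih =>
        rw [pow_succ, ih]
        have := DualNumber.eps_mul_eps (R := ℂ)
        push_cast
        linear_combination (e : DualNumber ℂ) * this
    · intro i' _ hi'
      simp [c, hi']
    · simp
  rw [svForm_mul, h3] at h1
  simp only [DualNumber.snd_mul, h2.1, h2.2, mul_zero, zero_add] at h1
  rw [Fintype.sum_sigma, Finset.sum_eq_single i] at h1
  · simpa [c] using h1.symm
  · intro i' _ hi'
    simp [c, hi']
  · simp

/-- As the last degree is one, exactly one variable of the last group occurs in each monomial. -/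
theorem svMonomial_update_last {R : Type} [CommRing R] (hd : d (Fin.last r) = 1)
    (Y : (i : Fin (r + 1)) → Fin (n i + 1) → R) (s : R) (z z' : Fin (n (Fin.last r) + 1) → R)
    (J : SVIndex n d) :
    svMonomial (Function.update Y (Fin.last r) fun k => s * z k + z' k) J =
      s * svMonomial (Function.update Y (Fin.last r) z) J +
        svMonomial (Function.update Y (Fin.last r) z') J := by
  have h : ∀ z, svMonomial (Function.update Y (Fin.last r) z) J =
      (∏ i : Fin r, ((J i.castSucc : Multiset (Fin (n i.castSucc + 1))).map (Y i.castSucc)).prod) *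
        ((J (Fin.last r) : Multiset (Fin (n (Fin.last r) + 1))).map z).prod := fun z => by
    rw [svMonomial, Fin.prod_univ_castSucc, Function.update_self]
    congr 1
    refine Finset.prod_congr rfl fun i _ => ?_
    rw [Function.update_of_ne (Fin.castSucc_ne_last i)]
  obtain ⟨k, hk⟩ := Multiset.card_eq_one.mp ((J (Fin.last r)).2.trans hd)
  have hk' : (J (Fin.last r) : Multiset (Fin (n (Fin.last r) + 1))) = {k} := hk
  rw [h, h, h, hk']
  simp only [Multiset.map_singleton, Multiset.prod_singleton]
  ring

theorem svForm_update_last {R : Type} [CommRing R] [Algebra ℂ R] (hd : d (Fin.last r) = 1)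
    (a : SVIndex n d → ℂ)
    (Y : (i : Fin (r + 1)) → Fin (n i + 1) → R) (s : R) (z z' : Fin (n (Fin.last r) + 1) → R) :
    svForm a (Function.update Y (Fin.last r) fun k => s * z k + z' k) =
      s * svForm a (Function.update Y (Fin.last r) z) +
        svForm a (Function.update Y (Fin.last r) z') := by
  simp only [svForm, svMonomial_update_last hd, Finset.mul_sum, ← Finset.sum_add_distrib]
  exact Finset.sum_congr rfl fun _ _ => by ring

theorem svMonomial_update_last_zero {R : Type} [CommRing R] (hd : d (Fin.last r) = 1)
    (Y : (i : Fin (r + 1)) → Fin (n i + 1) → R) (J : SVIndex n d) :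
    svMonomial (Function.update Y (Fin.last r) 0) J = 0 := by
  have h := svMonomial_update_last hd Y 1 0 0 J
  rw [show (fun k => (1 : R) * (0 : Fin (n (Fin.last r) + 1) → R) k +
    (0 : Fin (n (Fin.last r) + 1) → R) k) = 0 from by funext k; simp] at h
  linear_combination (-1) * h

/-- The embedding of the last factor, as a linear map. -/
def lastFactorMap (hd : d (Fin.last r) = 1) (y : (i : Fin (r + 1)) → Fin (n i + 1) → ℂ) :
    (Fin (n (Fin.last r) + 1) → ℂ) →ₗ[ℂ] (SVIndex n d → ℂ) where
  toFun z := svVec n d (Function.update y (Fin.last r) z)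
  map_add' z z' := by
    funext J
    have h := svMonomial_update_last hd y 1 z z' J
    rw [show (fun k => (1 : ℂ) * z k + z' k) = z + z' from by funext k; simp, one_mul] at h
    exact h
  map_smul' c z := by
    funext J
    have h := svMonomial_update_last hd y c z 0 J
    rw [show (fun k => c * z k + (0 : Fin (n (Fin.last r) + 1) → ℂ) k) = c • z from by
      funext k; simp, svMonomial_update_last_zero hd, add_zero] at h
    exact h

theorem lastFactorMap_injective (hd : d (Fin.last r) = 1)
    {y : (i : Fin (r + 1)) → Fin (n i + 1) → ℂ} (hy : ∀ i, y i ≠ 0) :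
    LinearMap.ker (lastFactorMap hd y) = ⊥ := by
  rw [LinearMap.ker_eq_bot']
  intro z hz
  by_contra h
  refine svVec_ne_zero n d (Function.update y (Fin.last r) z) (fun i => ?_) hz
  by_cases hi : i = Fin.last r
  · subst hi
    rwa [Function.update_self]
  · rw [Function.update_of_ne hi]
    exact hy i

/-- A derivative in another group is the `ε`-coefficient of the form at a dual point, and there the
form is still linear in the last group. -/
theorem svPartial_update_last (hd : d (Fin.last r) = 1) (a : SVIndex n d → ℂ)
    (y : (i : Fin (r + 1)) → Fin (n i + 1) → ℂ) {p : Σ i : Fin (r + 1), Fin (n i + 1)}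
    (hp : p.1 ≠ Fin.last r) (c : ℂ) (z z' : Fin (n (Fin.last r) + 1) → ℂ) :
    svPartial a p (Function.update y (Fin.last r) fun k => c * z k + z' k) =
      c * svPartial a p (Function.update y (Fin.last r) z) +
        svPartial a p (Function.update y (Fin.last r) z') := by
  classical
  let Y : (i : Fin (r + 1)) → Fin (n i + 1) → DualNumber ℂ := fun i k =>
    dualPoint (fun q : Σ i : Fin (r + 1), Fin (n i + 1) => y q.1 q.2) (Pi.single p 1) ⟨i, k⟩
  have key : ∀ z : Fin (n (Fin.last r) + 1) → ℂ,
      (svForm a (Function.update Y (Fin.last r) fun k => TrivSqZeroExt.inl (z k))).snd =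
        svPartial a p (Function.update y (Fin.last r) z) := by
    intro z
    rw [(fst_snd_svForm a _ (y := Function.update y (Fin.last r) z) fun i k => ?_).2,
      Finset.sum_eq_single p]
    · rw [Function.update_of_ne hp]
      simp [Y, dualPoint]
    · rintro ⟨i, k⟩ _ hq
      by_cases hi : i = Fin.last r
      · subst hi
        simp
      · simp [Function.update_of_ne hi, Y, dualPoint, hq]
    · simp
    · by_cases hi : i = Fin.last r
      · subst hi
        simp
      · simp [Function.update_of_ne hi, Y, dualPoint]
  have h := congrArg TrivSqZeroExt.snd (svForm_update_last hd a Y (TrivSqZeroExt.inl c)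
    (fun k => TrivSqZeroExt.inl (z k)) fun k => TrivSqZeroExt.inl (z' k))
  simp only [← TrivSqZeroExt.inl_mul, ← TrivSqZeroExt.inl_add, TrivSqZeroExt.snd_add,
    DualNumber.snd_mul, TrivSqZeroExt.fst_inl, TrivSqZeroExt.snd_inl, zero_mul, add_zero, key] at h
  exact h

/-- If the last degree is one, a form that is critical at a point is critical along a linear space
of the last factor. -/
theorem exists_submodule_isCritical_update_last (hd : d (Fin.last r) = 1) {a : SVIndex n d → ℂ}
    {y : (i : Fin (r + 1)) → Fin (n i + 1) → ℂ} (hy : ∀ i, y i ≠ 0) (h : IsCritical a y) :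
    ∃ K : Submodule ℂ (Fin (n (Fin.last r) + 1) → ℂ), y (Fin.last r) ∈ K ∧
      n (Fin.last r) + 1 ≤ Module.finrank ℂ K + ∑ i : Fin r, n i.castSucc ∧
      ∀ z ∈ K, IsCritical a (Function.update y (Fin.last r) z) := by
  classical
  have hk : ∀ i, ∃ k, y i k ≠ 0 := fun i => Function.ne_iff.mp (hy i)
  choose k hk using hk
  -- One nonzero coordinate of `y` is left out in each factor, so that only `n i` conditions are
  -- imposed per factor; Euler's relation supplies the missing derivative.
  let T := Σ i : Fin r, {b : Fin (n i.castSucc + 1) // b ≠ k i.castSucc}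
  have hadd := fun (q : T) => svPartial_update_last hd a y (p := ⟨q.1.castSucc, q.2.1⟩)
    (Fin.castSucc_ne_last _)
  have hzero : ∀ q : T, svPartial a ⟨q.1.castSucc, q.2.1⟩ (Function.update y (Fin.last r) 0) = 0 := by
    intro q
    have := hadd q 1 0 0
    rw [show (fun k => (1 : ℂ) * (0 : Fin (n (Fin.last r) + 1) → ℂ) k +
      (0 : Fin (n (Fin.last r) + 1) → ℂ) k) = 0 from by funext k; simp] at this
    linear_combination (-1) * this
  let Ψ : (Fin (n (Fin.last r) + 1) → ℂ) →ₗ[ℂ] (T → ℂ) :=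
    { toFun := fun z q => svPartial a ⟨q.1.castSucc, q.2.1⟩ (Function.update y (Fin.last r) z)
      map_add' := fun z z' => by
        funext q
        have := hadd q 1 z z'
        rw [show (fun k => (1 : ℂ) * z k + z' k) = z + z' from by funext k; simp, one_mul] at this
        exact this
      map_smul' := fun c z => by
        funext q
        have := hadd q c z 0
        rw [show (fun k => c * z k + (0 : Fin (n (Fin.last r) + 1) → ℂ) k) = c • z from by
          funext k; simp, hzero, add_zero] at this
        exact this }
  let e : (i : Fin (r + 1)) → Fin (n i + 1) → DualNumber ℂ := fun i k => TrivSqZeroExt.inl (y i k)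
  have hfst : ∀ (w z : Fin (n (Fin.last r) + 1) → ℂ) (i : Fin (r + 1)) (k : Fin (n i + 1)),
      (Function.update e (Fin.last r) (fun k => DualNumber.eps * TrivSqZeroExt.inl (w k) +
        TrivSqZeroExt.inl (z k)) i k).fst = Function.update y (Fin.last r) z i k := by
    intro w z i k
    by_cases hi : i = Fin.last r
    · subst hi
      simp
    · simp [Function.update_of_ne hi, e]
  have hlin : ∀ w z : Fin (n (Fin.last r) + 1) → ℂ, svForm a (Function.update e (Fin.last r)
      fun k => DualNumber.eps * TrivSqZeroExt.inl (w k) + TrivSqZeroExt.inl (z k)) =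
        DualNumber.eps * TrivSqZeroExt.inl (svForm a (Function.update y (Fin.last r) w)) +
          TrivSqZeroExt.inl (svForm a (Function.update y (Fin.last r) z)) := by
    intro w z
    have h2 : ∀ z : Fin (n (Fin.last r) + 1) → ℂ,
        svForm a (Function.update e (Fin.last r) fun k => TrivSqZeroExt.inl (z k)) =
          TrivSqZeroExt.inl (svForm a (Function.update y (Fin.last r) z)) := by
      intro z
      refine Eq.trans ?_ (map_svForm (TrivSqZeroExt.inlAlgHom ℂ ℂ ℂ) a _).symm
      congr 1
      funext i k
      by_cases hi : i = Fin.last r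
      · subst hi
        simp
      · simp [Function.update_of_ne hi, e]
    rw [svForm_update_last hd, h2, h2]
  -- By linearity in the last group, the derivative at `y` in the direction `z` is the value of the
  -- form at `z`, and it vanishes because `y` is critical.
  have hform : ∀ z, svForm a (Function.update y (Fin.last r) z) = 0 := by
    intro z
    have h1 := h (Function.update e (Fin.last r) fun k => DualNumber.eps * TrivSqZeroExt.inl (z k) +
      TrivSqZeroExt.inl (y (Fin.last r) k)) fun i k => by
        rw [hfst, Function.update_eq_self]
    rw [hlin] at h1
    simpa using congrArg TrivSqZeroExt.snd h1
  refine ⟨LinearMap.ker Ψ, ?_, ?_, fun z hz => ?_⟩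
  · rw [LinearMap.mem_ker]
    funext q
    change svPartial a _ (Function.update y (Fin.last r) (y (Fin.last r))) = 0
    rw [Function.update_eq_self]
    exact ((isCritical_iff_svPartial a y).mp h).2 _
  · have h1 := Ψ.finrank_range_add_finrank_ker
    have h2 := Submodule.finrank_le (LinearMap.range Ψ)
    have h3 : Fintype.card T = ∑ i : Fin r, n i.castSucc := by
      simp [T, Fintype.card_sigma]
    rw [Module.finrank_fintype_fun_eq_card] at h1 h2
    rw [h3] at h2
    rw [Fintype.card_fin] at h1
    lia
  · rw [isCritical_iff_svPartial]
    refine ⟨hform z, ?_⟩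
    rintro ⟨i, b⟩
    by_cases hi : i = Fin.last r
    · subst hi
      -- A partial derivative in the last group is the value of the form at a basis vector, which is
      -- zero by `hform`.
      have h1 := (fst_snd_svForm a _ (hfst (Pi.single b 1) z)).2
      rw [hlin, hform, hform, Finset.sum_eq_single ⟨Fin.last r, b⟩] at h1
      · simpa using h1.symm
      · rintro ⟨i, k⟩ _ hq
        by_cases hi : i = Fin.last r
        · subst hi
          have hkb : k ≠ b := fun h => hq (by rw [h])
          simp [hkb]
        · simp [Function.update_of_ne hi, e]
      · simp
    · obtain ⟨i, rfl⟩ : ∃ i' : Fin r, i = i'.castSucc :=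
        ⟨i.castPred hi, (Fin.castSucc_castPred _ _).symm⟩
      have hne : ∀ b, b ≠ k i.castSucc →
          svPartial a ⟨i.castSucc, b⟩ (Function.update y (Fin.last r) z) = 0 := fun b hb =>
        congrFun (LinearMap.mem_ker.mp hz) (⟨i, b, hb⟩ : T)
      by_cases hb : b = k i.castSucc
      · subst hb
        have h1 := sum_svPartial_mul a (Function.update y (Fin.last r) z) i.castSucc
        rw [hform, mul_zero, Finset.sum_eq_single (k i.castSucc), Function.update_of_ne hi] at h1
        · exact (mul_eq_zero.mp h1).resolve_right (hk _)
        · intro b _ hb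
          rw [hne b hb, zero_mul]
        · simp
      · exact hne b hb

end

/-! ### Linear spaces in the contact locus -/

section

variable {r : ℕ} {n d : Fin (r + 1) → ℕ}

theorem mem_tangentHyperplanes_iff (hd : ∀ i, 0 < d i) {x : PTuple 1 (SVIndex n d)}
    {y : (i : Fin (r + 1)) → Fin (n i + 1) → ℂ} (hy : ∀ i, y i ≠ 0)
    (hx : (x 0).coord = svVec n d y) (a : PSpace (SVIndex n d)) :
    a ∈ tangentHyperplanes (segreVeronese n d) x ↔ IsCritical a.coord y := by
  change (⨆ i, tangentSpaceAt (segreVeronese n d) (x i)) ≤ hyperplane a ↔ _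
  rw [← tangentSpaceAt_le_hyperplane_iff hd hy hx, iSup_le_iff]
  refine ⟨fun h => h 0, fun h i => ?_⟩
  obtain rfl : i = 0 := Subsingleton.elim _ _
  exact h

/-- If the last degree is one, every contact locus contains a linear space of positive dimension. -/
theorem exists_linearSpacePoints_subset_contactLocus (hd : ∀ i, 0 < d i)
    (hlast : d (Fin.last r) = 1) {x : PTuple 1 (SVIndex n d)}
    (hx : x ∈ tuplesIn 1 (segreVeronese n d)) {a : PSpace (SVIndex n d)}
    (ha : a ∈ tangentHyperplanes (segreVeronese n d) x) :
    ∃ L : Submodule ℂ (SVIndex n d → ℂ),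
      n (Fin.last r) + 1 ≤ Module.finrank ℂ L + ∑ i : Fin r, n i.castSucc ∧
      (linearSpacePoints L).Nonempty ∧
      linearSpacePoints L ⊆ contactLocus (segreVeronese n d) x a := by
  obtain ⟨y, hy, hxy⟩ := (mem_segreVeronese_iff hd (x 0)).mp (hx 0)
  rw [mem_tangentHyperplanes_iff hd hy hxy] at ha
  obtain ⟨K, hyK, hK, hcrit⟩ := exists_submodule_isCritical_update_last hlast hy ha
  have hker := lastFactorMap_injective (d := d) hlast hy
  have hxL : x 0 ∈ linearSpacePoints (K.map (lastFactorMap hlast y)) := by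
    refine ⟨y (Fin.last r), hyK, ?_⟩
    rw [hxy]
    change svVec n d (Function.update y (Fin.last r) (y (Fin.last r))) = _
    rw [Function.update_eq_self]
  have hsing : linearSpacePoints (K.map (lastFactorMap hlast y)) ⊆
      singHyperplaneSection (segreVeronese n d) a := by
    rintro x' ⟨z, hz, hx'⟩
    have hz0 : z ≠ 0 := by
      rintro rfl
      rw [map_zero] at hx'
      exact x'.coord_ne_zero hx'.symm
    have hy' : ∀ i, Function.update y (Fin.last r) z i ≠ 0 := by
      intro i
      by_cases hi : i = Fin.last r
      · subst hi
        rwa [Function.update_self]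
      · rw [Function.update_of_ne hi]
        exact hy i
    exact ⟨(mem_segreVeronese_iff hd x').mpr ⟨_, hy', hx'.symm⟩,
      (tangentSpaceAt_le_hyperplane_iff hd hy' hx'.symm).mpr (hcrit z hz)⟩
  -- The linear space is irreducible and passes through `x 0`, so a component containing it is part
  -- of the contact locus.
  obtain ⟨C, hC, hLC⟩ := exists_mem_componentsOf_superset
    ⟨⟨_, hxL⟩, isPreirreducible_linearSpacePoints _⟩ hsing
  refine ⟨K.map (lastFactorMap hlast y), ?_, ⟨_, hxL⟩,
    fun z hz => ⟨C, ⟨hC, 0, hLC hxL⟩, hLC hz⟩⟩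
  rwa [← (Submodule.equivMapOfInjective _ (LinearMap.ker_eq_bot.mp hker) K).finrank_eq]

theorem exists_dotProduct_eq_zero {m : ℕ} (hm : 0 < m) (y : Fin (m + 1) → ℂ) :
    ∃ l : Fin (m + 1) → ℂ, l ≠ 0 ∧ ∑ k, l k * y k = 0 := by
  have hne : (0 : Fin (m + 1)) ≠ Fin.last m := fun h => by
    have := congrArg Fin.val h
    simp at this
    lia
  by_cases h : y 0 = 0
  · refine ⟨Pi.single 0 1, by simp, ?_⟩
    rw [Finset.sum_eq_single 0] <;> simp +contextual [h]
  · refine ⟨Pi.single 0 (y (Fin.last m)) - Pi.single (Fin.last m) (y 0), fun h0 => h ?_, ?_⟩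
    · have := congrFun h0 (Fin.last m)
      simpa [hne.symm] using this
    · simp [sub_mul, Finset.sum_sub_distrib, Pi.single_apply]
      ring

/-- Every point of the Segre-Veronese variety has a tangent hyperplane. -/
theorem exists_ne_zero_isCritical (hn : ∀ i, 0 < n i) (hD : 2 ≤ ∑ i, d i)
    (y : (i : Fin (r + 1)) → Fin (n i + 1) → ℂ) :
    ∃ a : SVIndex n d → ℂ, a ≠ 0 ∧ IsCritical a y := by
  choose l hl hly using fun i => exists_dotProduct_eq_zero (hn i) (y i)
  -- With every row of the matrix equal to `l i`, the form is the product of the `(l i) ^ d i`. It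
  -- has at least two linear factors, and all of them vanish at `y`.
  obtain ⟨a, ha⟩ := exists_svForm_eq_linearSubst
    (Pi.single (slotIndex (n := n) (d := d) fun _ _ => 0) 1) (fun i => Matrix.of fun _ k => l i k)
  refine ⟨a, ?_, ?_⟩
  · rintro rfl
    choose k hk using fun i => Function.ne_iff.mp (hl i)
    have h := ha ℂ fun i => Pi.single (k i) 1
    rw [svForm_zero, svForm_single, svMonomial_slotIndex] at h
    refine Finset.prod_ne_zero_iff.mpr (fun i _ => Finset.prod_ne_zero_iff.mpr fun _ _ => ?_) h.symm
    simpa [linearSubst, Pi.single_apply] using hk i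
  · have hcard : 1 < Fintype.card (Σ i, Fin (d i)) := by
      simp only [Fintype.card_sigma, Fintype.card_fin]
      lia
    obtain ⟨s, t, hst⟩ := Fintype.one_lt_card_iff.mp hcard
    refine IsCritical.of_svForm_eq ha (isCritical_single hst ?_ ?_) <;>
    simpa [linearSubst] using hly _

end

/-! ### The proposition -/

theorem mainTheorem11 (r : ℕ) (n d : Fin (r + 1) → ℕ)
    (hn_pos : ∀ i, 0 < n i) (hd_pos : ∀ i, 0 < d i) (hn_mono : Monotone n)
    (hd_sum : 3 ≤ ∑ i, d i)
    (hn_last : ∑ i : Fin r, n i.castSucc < n (Fin.last r)) :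
    (2 ≤ d (Fin.last r) →
      ¬ (r = 1 ∧ n 0 = 1 ∧ n (Fin.last r) = 2 ∧ d 0 = 1 ∧ d (Fin.last r) = 2) →
      ¬ IsWeaklyDefective (segreVeronese n d) (n 0 + 1)) ∧
    (d (Fin.last r) = 1 →
      IsWeaklyDefective (segreVeronese n d) 1 ∧
      ForGeneral (tuplesIn 1 (segreVeronese n d)) fun x =>
        ForGeneral (tangentHyperplanes (segreVeronese n d) x) fun a =>
          ContainsLinearSpace (contactLocus (segreVeronese n d) x a)
            (n (Fin.last r) - ∑ i : Fin r, n i.castSucc)) := by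
  refine ⟨fun hd hexc => not_isWeaklyDefective_segreVeronese r n d hn_pos hd_pos hn_mono hd_sum
    hn_last hd hexc, fun hd => ?_⟩
  -- Here the conclusions hold for every point and every tangent hyperplane, so the open sets are
  -- the whole spaces and only nonemptiness is to be checked.
  have hgen : ∀ P : PTuple 1 (SVIndex n d) → PSpace (SVIndex n d) → Prop,
      (∀ x ∈ tuplesIn 1 (segreVeronese n d), ∀ a ∈ tangentHyperplanes (segreVeronese n d) x, P x a) →
      ForGeneral (tuplesIn 1 (segreVeronese n d)) fun x =>
        ForGeneral (tangentHyperplanes (segreVeronese n d) x) fun a => P x a := by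
    intro P hP
    refine ⟨Set.univ, isOpen_univ, ?_, fun x hx => ⟨Set.univ, isOpen_univ, ?_, fun a ha =>
      hP x hx.1 a ha.1⟩⟩
    · have hy : ∀ i, (fun _ => 1 : Fin (n i + 1) → ℂ) ≠ 0 := fun i h => one_ne_zero (congrFun h 0)
      rw [Set.inter_univ]
      exact ⟨fun _ => PSpace.mk _ (svVec_ne_zero n d _ hy),
        fun _ => mem_segreVeronese_of_isCoord hy (isCoord_mk _ _)⟩
    · obtain ⟨y, hy, hxy⟩ := (mem_segreVeronese_iff hd_pos (x 0)).mp (hx.1 0)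
      obtain ⟨a, ha0, ha⟩ := exists_ne_zero_isCritical (d := d) hn_pos (by lia) y
      rw [Set.inter_univ]
      exact ⟨PSpace.mk a ha0, (mem_tangentHyperplanes_iff hd_pos hy hxy _).mpr
        ((isCritical_iff_of_isCoord (isCoord_mk a ha0) y).mpr ha)⟩
  refine ⟨hgen _ fun x hx a ha => ?_, hgen _ fun x hx a ha => ?_⟩
  · obtain ⟨L, hL, hne, hLC⟩ := exists_linearSpacePoints_subset_contactLocus hd_pos hd hx ha
    exact topologicalKrullDim_pos_of_isIrreducible ⟨hne, isPreirreducible_linearSpacePoints L⟩ hLC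
      (nontrivial_linearSpacePoints (by lia))
  · obtain ⟨L, hL, -, hLC⟩ := exists_linearSpacePoints_subset_contactLocus hd_pos hd hx ha
    -- `L` may be larger than required and is cut down to the exact dimension; the natural-number
    -- subtraction is a true one by `hn_last`.
    obtain ⟨L', hL', hfin⟩ := exists_submodule_le_finrank_eq L
      (m := n (Fin.last r) - ∑ i : Fin r, n i.castSucc + 1) (by lia)
    exact ⟨L', hfin, fun z hz => hLC (hL' hz)⟩

end
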